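/- Let $F$ be a Ferrers shape in French notation (the left-justified, bottom-justified arrangement of cells of a partition, with weakly decreasing row lengths from bottom to top), let $n$ be a non-negative integer and let $s$ and $t$ be positive integers. A filling of $F$ assigns a non-negative integer to each cell of $F$; a $0$-$1$-filling uses only the entries $0$ and $1$. For a string $XY$ with $X\in\{N,n,S,s\}$ and $Y\in\{E,e\}$, an $XY$-chain of a filling is a sequence of non-zero entries in distinct cells such that each entry lies, relative to the preceding one, above it if $X\in\{N,n\}$ and below it if $X\in\{S,s\}$, and to the right of it; here a capital letter means weakly and a lower-case letter means strictly, in the vertical direction for $X$ and in the horizontal direction for $Y$. Only chains such that the smallest rectangle containing the chain is contained in $F$ are considered (this is automatic for $X\in\{N,n\}$). The length of an $\mathit{NE}$-chain or an $\mathit{SE}$-chain is the sum of its entries; the length of a chain of any of the other types is the number of its entries. Write $N^*(F;n;\mathit{NE}=s,\mathit{se}=t)$ for the number of fillings of $F$ with sum of entries $n$ whose longest $\mathit{NE}$-chain has length $s$ and whose longest $\mathit{se}$-chain has length $t$, and $N^{01}(F;n;\mathit{nE}=s,\mathit{Se}=t)$ for the number of $0$-$1$-fillings of $F$ with sum of entries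 $n$ whose longest $\mathit{nE}$-chain has length $s$ and whose longest $\mathit{Se}$-chain has length $t$; the notations $N^*(F;n;\mathit{ne}=t,\mathit{SE}=s)$ and $N^{01}(F;n;\mathit{Ne}=t,\mathit{sE}=s)$ have the analogous meaning. Then $$N^*(F;n;\mathit{NE}=s,\mathit{se}=t)=N^*(F;n;\mathit{ne}=t,\mathit{SE}=s)$$ and $$N^{01}(F;n;\mathit{nE}=s,\mathit{Se}=t)=N^{01}(F;n;\mathit{Ne}=t,\mathit{sE}=s).$$ -/

import Mathlib

/-! Fillings of Ferrers shapes and their chains.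

A Ferrers shape is a `YoungDiagram`, read in French notation: the cell `(i, j)` lies in the `i`-th
row counted from the bottom and in the `j`-th column counted from the left. Going up means
that `i` grows, and going to the right means that `j` grows. -/

namespace FerrersFilling

/-- The cells of the Ferrers shape `F`, as a type. -/
abbrev Cell (F : YoungDiagram) : Type := {c : ℕ × ℕ // c ∈ F}

instance (F : YoungDiagram) : Fintype (Cell F) :=
  inferInstanceAs (Fintype {c : ℕ × ℕ // c ∈ F.cells})

/-- The row of a cell, counted from the bottom. -/
def Cell.row {F : YoungDiagram} (c : Cell F) : ℕ := c.1.1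

/-- The column of a cell, counted from the left. -/
def Cell.col {F : YoungDiagram} (c : Cell F) : ℕ := c.1.2

/-- A filling of the cells of `F` with non-negative integers. -/
abbrev Filling (F : YoungDiagram) : Type := Cell F → ℕ

/-! The eight directions. `Dir a b` says that `b` lies in the given direction from `a`. A lower-case
letter stands for "strictly", a capital letter for "weakly". -/

/-- `b` is weakly above and weakly to the right of `a`. -/
def NE {F : YoungDiagram} (a b : Cell F) : Prop := a.row ≤ b.row ∧ a.col ≤ b.col

/-- `b` is strictly above and strictly to the right of `a`. -/
def ne {F : YoungDiagram} (a b : Cell F) : Prop := a.row < b.row ∧ a.col < b.col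

/-- `b` is strictly above and weakly to the right of `a`. -/
def nE {F : YoungDiagram} (a b : Cell F) : Prop := a.row < b.row ∧ a.col ≤ b.col

/-- `b` is weakly above and strictly to the right of `a`. -/
def Ne {F : YoungDiagram} (a b : Cell F) : Prop := a.row ≤ b.row ∧ a.col < b.col

/-- `b` is weakly below and weakly to the right of `a`. -/
def SE {F : YoungDiagram} (a b : Cell F) : Prop := b.row ≤ a.row ∧ a.col ≤ b.col

/-- `b` is strictly below and strictly to the right of `a`. -/
def se {F : YoungDiagram} (a b : Cell F) : Prop := b.row < a.row ∧ a.col < b.col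

/-- `b` is strictly below and weakly to the right of `a`. -/
def sE {F : YoungDiagram} (a b : Cell F) : Prop := b.row < a.row ∧ a.col ≤ b.col

/-- `b` is weakly below and strictly to the right of `a`. -/
def Se {F : YoungDiagram} (a b : Cell F) : Prop := b.row ≤ a.row ∧ a.col < b.col

/-- The cell `(i, j)` of the plane lies in the smallest rectangle that contains all cells of `l`. -/
def InBoundingRectangle {F : YoungDiagram} (l : List (Cell F)) (i j : ℕ) : Prop :=
  (∃ a ∈ l, a.row ≤ i) ∧ (∃ b ∈ l, i ≤ b.row) ∧ (∃ a ∈ l, a.col ≤ j) ∧ (∃ b ∈ l, j ≤ b.col)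

/-- `l` is a chain of the filling `f` in the direction `Dir`, the smallest rectangle containing
the chain being contained in `F`. (For the four north-east directions the last condition always
holds, because the last cell of the chain is the top right corner of the rectangle.) -/
structure IsFillingChain {F : YoungDiagram} (f : Filling F) (Dir : Cell F → Cell F → Prop)
    (l : List (Cell F)) : Prop where
  /-- every cell lies in the direction `Dir` from the preceding one -/
  step : l.IsChain Dir
  /-- no cell is used twice -/
  nodup : l.Nodup
  /-- the entries of the chain are non-zero -/
  nonzero : ∀ c ∈ l, f c ≠ 0
  /-- the smallest rectangle containing the chain is contained in `F` -/
  rectangle : ∀ i j : ℕ, InBoundingRectangle l i j → (i, j) ∈ F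

/-- The longest chain of `f` in the direction `Dir` has length `s`, where the length of a chain is
the number of its entries. -/
def LongestByCard {F : YoungDiagram} (f : Filling F) (Dir : Cell F → Cell F → Prop) (s : ℕ) :
    Prop :=
  IsGreatest {m : ℕ | ∃ l : List (Cell F), IsFillingChain f Dir l ∧ l.length = m} s

/-- The longest chain of `f` in the direction `Dir` has length `s`, where the length of a chain is
the sum of its entries. -/
def LongestBySum {F : YoungDiagram} (f : Filling F) (Dir : Cell F → Cell F → Prop) (s : ℕ) :
    Prop :=
  IsGreatest {m : ℕ | ∃ l : List (Cell F), IsFillingChain f Dir l ∧ (l.map f).sum = m} s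

/-- The fillings of `F` with non-negative integers with sum of entries `n`. -/
def fillings (F : YoungDiagram) (n : ℕ) : Set (Filling F) :=
  {f | ∑ c, f c = n}

/-- The `0`-`1`-fillings of `F` with sum of entries `n`. -/
def fillings01 (F : YoungDiagram) (n : ℕ) : Set (Filling F) :=
  {f | (∀ c, f c = 0 ∨ f c = 1) ∧ ∑ c, f c = n}

theorem fillings_finite (F : YoungDiagram) (n : ℕ) : (fillings F n).Finite :=
  (Set.finite_Iic (fun _ : Cell F => n)).subset fun f hf c =>
    (Finset.single_le_sum (f := f) (fun _ _ => Nat.zero_le _) (Finset.mem_univ c)).trans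
      (le_of_eq hf)

/-- The number of fillings with sum `n`, longest NE-chain of length `s` and
longest se-chain of length `t`. -/
noncomputable def countNEse (F : YoungDiagram) (n s t : ℕ) : ℕ :=
  {f ∈ fillings F n | LongestBySum f NE s ∧ LongestByCard f se t}.ncard

/-- The number of fillings with sum `n`, longest ne-chain of length `s` and
longest SE-chain of length `t`. -/
noncomputable def countneSE (F : YoungDiagram) (n s t : ℕ) : ℕ :=
  {f ∈ fillings F n | LongestByCard f ne s ∧ LongestBySum f SE t}.ncard

/-- The number of `0`-`1`-fillings with sum `n`, longest nE-chain of length `s` and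
longest Se-chain of length `t`. -/
noncomputable def count01nESe (F : YoungDiagram) (n s t : ℕ) : ℕ :=
  {f ∈ fillings01 F n | LongestByCard f nE s ∧ LongestByCard f Se t}.ncard

/-- The number of `0`-`1`-fillings with sum `n`, longest Ne-chain of length `s` and
longest sE-chain of length `t`. -/
noncomputable def count01NesE (F : YoungDiagram) (n s t : ℕ) : ℕ :=
  {f ∈ fillings01 F n | LongestByCard f Ne s ∧ LongestByCard f sE t}.ncard

end FerrersFilling

/-! The proof uses Fomin's growth diagrams. Every lattice point receives a partition, the empty one
on the axes, and each cell determines the partition at its upper right corner from the other three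
corners and its entry by a local rule. There are four rules, variants of the
Robinson-Schensted-Knuth correspondence, indexed by the strictness flags `(a, b)`: a vertical step
adds a vertical strip if `a` and a horizontal strip otherwise, and a horizontal step does the same
with `b`. The rules are invertible, so removing corners one at a time shows that fillings of `F`
correspond to sequences of partitions along the boundary (`filling_unique`, `exists_filling`).
Conjugating all partitions exchanges the two kinds of strips, hence turns data for `(a, b)` into
data for `(!a, !b)`: this pairs NE with ne and nE with Ne.

The partition at `(I, J)` knows three things about the rectangle below and to the left: its size is
the sum of the entries (`sum_shape`), its first row is the longest forward chain
(`isGreatest_growth`), and its number of rows is the longest dual chain. Conjugation keeps the first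
and exchanges the other two. A chain whose bounding rectangle fits into `F` lies below some boundary
point, so chain lengths in `F` are maxima along the boundary.

For the first row, the local rule is the dynamic programming recursion for longest chains. The later
rows are the growth of the `derived` filling, so instead of the full theorem of Greene it suffices
that passing to the derived filling shortens the longest dual chain by exactly one
(`isGreatest_conj_shape`). If dual chains are strict in some direction, non-zero cells of a filling
and of its derived filling interlace. If they are weak in both, sums along staircase paths are
compared by telescoping. -/

namespace FerrersGrowth

/-! ### Partitions as sequences of row lengths -/

/-- A partition, given by the weakly decreasing sequence of its row lengths. -/
structure IsPartition (f : ℕ → ℕ) : Prop where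
  antitone : Antitone f
  eventually_zero : ∃ N, f N = 0

/-- The conjugate partition. -/
noncomputable def conj (f : ℕ → ℕ) (k : ℕ) : ℕ := sInf {i | f i ≤ k}

theorem IsPartition.zero : IsPartition 0 := ⟨fun _ _ _ => le_rfl, 0, rfl⟩

theorem IsPartition.lt_conj {f : ℕ → ℕ} (hf : IsPartition f) {i k : ℕ} :
    i < conj f k ↔ k < f i := by
  obtain ⟨N, hN⟩ := hf.eventually_zero
  have hne : {i | f i ≤ k}.Nonempty := ⟨N, by simp [hN]⟩
  constructor
  · intro h
    by_contra hk
    exact absurd (Nat.sInf_le (show i ∈ {i | f i ≤ k} from not_lt.mp hk)) (not_le.mpr h)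
  · intro h
    by_contra hk
    have h1 : f (conj f k) ≤ k := Nat.sInf_mem hne
    have h2 := hf.antitone (not_lt.mp hk)
    omega

theorem IsPartition.conj {f : ℕ → ℕ} (hf : IsPartition f) : IsPartition (conj f) := by
  refine ⟨antitone_nat_of_succ_le fun k => ?_, f 0, ?_⟩
  · by_contra h
    have := hf.lt_conj.mp (not_le.mp h)
    have h' := (hf.lt_conj (i := FerrersGrowth.conj f k) (k := k)).mpr (by omega)
    omega
  · by_contra h
    have := hf.lt_conj.mp (Nat.pos_of_ne_zero h)
    omega

theorem IsPartition.conj_conj {f : ℕ → ℕ} (hf : IsPartition f) :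
    FerrersGrowth.conj (FerrersGrowth.conj f) = f := by
  funext k
  refine eq_of_forall_lt_iff fun i => ?_
  rw [hf.conj.lt_conj, hf.lt_conj]

/-- `lam / mu` is a vertical strip (if `a`) or a horizontal strip (otherwise). -/
def IsStrip (a : Bool) (lam mu : ℕ → ℕ) : Prop :=
  ∀ k, mu k ≤ lam k ∧ (a = true → lam k ≤ mu k + 1) ∧ (a = false → lam (k + 1) ≤ mu k)

theorem IsStrip.zero (a : Bool) : IsStrip a 0 0 := fun _ => by simp

/-- At most one new cell per row becomes at most one new cell per column. This is the only place
where the two kinds of strips are exchanged. -/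
theorem IsStrip.conj {a : Bool} {lam mu : ℕ → ℕ} (hl : IsPartition lam) (hm : IsPartition mu)
    (h : IsStrip a lam mu) : IsStrip (!a) (conj lam) (conj mu) := by
  intro k
  refine ⟨?_, ?_, ?_⟩
  · by_contra hk
    have h1 := hm.lt_conj.mp (not_le.mp hk)
    have h2 := (hl.lt_conj (i := FerrersGrowth.conj lam k) (k := k)).mpr (h1.trans_le (h _).1)
    omega
  · intro ha
    by_contra hk
    have h1 := hl.lt_conj.mp (not_le.mp hk)
    have h2 := (h (FerrersGrowth.conj mu k)).2.2 (by simpa using ha)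
    have h3 := (hm.lt_conj (i := FerrersGrowth.conj mu k) (k := k)).mpr (by omega)
    omega
  · intro ha
    by_contra hk
    have h1 := hl.lt_conj.mp (not_le.mp hk)
    have h2 := (h (FerrersGrowth.conj mu k)).2.1 (by simpa using ha)
    have h3 := (hm.lt_conj (i := FerrersGrowth.conj mu k) (k := k)).mpr (by omega)
    omega

/-- Both sums count the pairs `(i, k)` with `k < f i`; `M` and `N` only have to be large enough to
contain them all. -/
theorem sum_conj {f : ℕ → ℕ} (hf : IsPartition f) {M N : ℕ} (hM : f 0 ≤ M) (hN : f N = 0) :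
    ∑ k ∈ Finset.range M, conj f k = ∑ i ∈ Finset.range N, f i := by
  have h1 : ∀ k, conj f k = ∑ i ∈ Finset.range N, if k < f i then 1 else 0 := by
    intro k
    rw [← Finset.card_filter]
    have : (Finset.range N).filter (fun i => k < f i) = Finset.range (conj f k) := by
      ext i
      simp only [Finset.mem_filter, Finset.mem_range, hf.lt_conj]
      refine ⟨fun h => h.2, fun h => ⟨?_, h⟩⟩
      by_contra hi
      have := hf.antitone (not_lt.mp hi)
      omega
    rw [this, Finset.card_range]
  have h2 : ∀ i, f i = ∑ k ∈ Finset.range M, if k < f i then 1 else 0 := by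
    intro i
    rw [← Finset.card_filter]
    have : (Finset.range M).filter (fun k => k < f i) = Finset.range (f i) := by
      ext k
      simp only [Finset.mem_filter, Finset.mem_range]
      have := hf.antitone (Nat.zero_le i)
      omega
    rw [this, Finset.card_range]
  rw [Finset.sum_congr rfl fun k _ => h1 k, Finset.sum_comm]
  exact Finset.sum_congr rfl fun i _ => (h2 i).symm

/-! ### Local rules -/

/-- The entry that a row of a growth diagram hands over to the next row. -/
def nextCarry (out : ℕ → ℕ → ℕ → ℕ → ℕ) (r m n c : ℕ) : ℕ := c + m + n - (out r m n c + r)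

/-- Bounds for the change of one row length. -/
def StepBound (a : Bool) (x y : ℕ) : Prop := x ≤ y ∧ (a = true → y ≤ x + 1)

/-- The entries that are allowed: all, or `0` and `1` only. -/
def Allowed (a b : Bool) (c : ℕ) : Prop := a ≠ b → c ≤ 1

/-- The contribution of an entry to the length of a chain: the entry itself if the chains are weak
in both directions, and `1` for a non-zero entry otherwise. -/
def weight (a b : Bool) (c : ℕ) : ℕ := if a = false ∧ b = false then c else min 1 c

/-- The length of the longest chain that can be continued with the upper right cell. -/
def base (a b : Bool) (r m n : ℕ) : ℕ :=
  match a, b with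
  | false, false => max m n
  | true, true => r
  | true, false => m
  | false, true => n

/-- A local rule of a growth diagram. In a cell with lower left corner `r`, lower right corner `m`,
upper left corner `n` and entry `c`, the upper right corner is `out r m n c` (row by row, with
the entry replaced by `nextCarry` from one row to the next). -/
structure GrowthRule (a b : Bool) where
  out : ℕ → ℕ → ℕ → ℕ → ℕ
  back : ℕ → ℕ → ℕ → ℕ → ℕ
  out_zero : out 0 0 0 0 = 0
  back_zero : back 0 0 0 0 = 0
  -- A non-zero entry cannot pass through an empty row unnoticed, which forces the carries to die
  -- out.
  eq_zero_of_out : ∀ c, out 0 0 0 c = 0 → c = 0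
  out_eq : ∀ {r m n c}, Allowed a b c → out r m n c = max (max m n) (base a b r m n + weight a b c)
  forward : ∀ {r m n c}, StepBound a r n → StepBound b r m → Allowed a b c →
    StepBound a m (out r m n c) ∧ StepBound b n (out r m n c) ∧
    Allowed a b (nextCarry out r m n c) ∧
    nextCarry out r m n c + out r m n c + r = c + m + n ∧
    back (out r m n c) m n (nextCarry out r m n c) = r
  -- Here `c'` is bounded by the next row of the upper right partition, and the horizontal strip
  -- condition bounds that row by `m` or `n`. The bounds on `c` restore this invariant one row
  -- earlier.
  backward : ∀ {l m n c'}, StepBound a m l → StepBound b n l → Allowed a b c' →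
    (a = false → c' ≤ m) → (b = false → c' ≤ n) → (0 < c' → 0 < l) →
    StepBound a (back l m n c') n ∧ StepBound b (back l m n c') m ∧
    ∃ c, c + m + n = c' + l + back l m n c' ∧
    Allowed a b c ∧ (a = false ∨ b = false → c ≤ l) ∧ (0 < c → 0 < l) ∧
    out (back l m n c') m n c = l
  -- Primed letters belong to the next row. These inequalities between successive rows yield a
  -- partition and the horizontal strips.
  cross_forward : ∀ {r m n c r' m' n'}, StepBound a r n → StepBound b r m → StepBound a r' n' →
    StepBound b r' m' → Allowed a b c → r' ≤ r → m' ≤ m → n' ≤ n →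
    (a = false → n' ≤ r) → (b = false → m' ≤ r) →
    out r' m' n' (nextCarry out r m n c) ≤ out r m n c ∧
    (a = false → out r' m' n' (nextCarry out r m n c) ≤ m) ∧
    (b = false → out r' m' n' (nextCarry out r m n c) ≤ n)
  cross_backward : ∀ {l m n l' m' n' c' c''}, StepBound a m l → StepBound b n l →
    StepBound a m' l' → StepBound b n' l' → l' ≤ l → m' ≤ m → n' ≤ n →
    (a = false → l' ≤ m) → (b = false → l' ≤ n) → Allowed a b c' → Allowed a b c'' →
    (a = false → c'' ≤ m') → (b = false → c'' ≤ n') → (0 < c'' → 0 < l') →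
    c' + m' + n' = c'' + l' + back l' m' n' c'' →
    back l' m' n' c'' ≤ back l m n c' ∧ (a = false → n' ≤ back l m n c') ∧
    (b = false → m' ≤ back l m n c')

/-- The rule for chains that are weak in both directions. -/
def ruleNE : GrowthRule false false where
  out _ m n c := max m n + c
  back _ m n c := min m n - c
  out_zero := rfl
  back_zero := rfl
  eq_zero_of_out c := by simp
  out_eq := by simp only [Allowed, base, weight]; grind
  forward := by simp only [StepBound, Allowed, nextCarry]; grind
  backward := by
    simp only [StepBound, Allowed]
    intro l m n c' h1 h2 h3 h4 h5 h6
    refine ⟨by grind, by grind, l - max m n, ?_⟩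
    grind
  cross_forward := by simp only [StepBound, Allowed, nextCarry]; grind
  cross_backward := by simp only [StepBound, Allowed]; grind

/-- The rule for chains that are strict in both directions. -/
def rulene : GrowthRule true true where
  out r m n c := max (max m n) (r + min 1 c)
  back l m n c := min (min m n) (l - min 1 c)
  out_zero := rfl
  back_zero := rfl
  eq_zero_of_out c := by simp
  out_eq := by simp only [Allowed, base, weight]; grind
  forward := by
    simp only [StepBound, Allowed, nextCarry, forall_const]
    intros
    simp only [ne_eq, not_true_eq_false, false_implies, true_and]
    omega
  backward := by
    simp only [StepBound, Allowed, forall_const]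
    intro l m n c' h1 h2 h3 h4 h5 h6
    -- The balance equation solved for the entry.
    refine ⟨by omega, by omega, c' + l + min (min m n) (l - min 1 c') - (m + n), ?_⟩
    simp only [ne_eq, not_true_eq_false, false_implies, Bool.true_eq_false, or_self, true_and]
    omega
  cross_forward := by
    simp only [StepBound, Allowed, nextCarry, forall_const]
    intros
    simp only [Bool.true_eq_false, false_implies, and_true]
    omega
  cross_backward := by
    simp only [StepBound, Allowed, forall_const]
    intros
    simp only [Bool.true_eq_false, false_implies, and_true]
    omega

/-- The rule for chains that are strict in the vertical direction. -/
def rulenE : GrowthRule true false where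
  out _ m n c := max n (m + c)
  back _ m n c := min m (n - c)
  out_zero := rfl
  back_zero := rfl
  eq_zero_of_out c := by simp
  out_eq := by simp only [Allowed, base, weight]; grind
  forward := by simp only [StepBound, Allowed, nextCarry]; grind
  backward := by
    simp only [StepBound, Allowed]
    intro l m n c' h1 h2 h3 h4 h5 h6
    -- The balance equation solved for the entry, simplified by `min m (n - c') + max m (n - c') = m
    -- + (n - c')`.
    refine ⟨by grind, by grind, l - max m (n - c'), ?_⟩
    grind
  cross_forward := by simp only [StepBound, Allowed, nextCarry]; grind
  cross_backward := by simp only [StepBound, Allowed]; grind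

/-- The rule for chains that are strict in the horizontal direction. -/
def ruleNe : GrowthRule false true where
  out _ m n c := max m (n + c)
  back _ m n c := min n (m - c)
  out_zero := rfl
  back_zero := rfl
  eq_zero_of_out c := by simp
  out_eq := by simp only [Allowed, base, weight]; grind
  forward := by simp only [StepBound, Allowed, nextCarry]; grind
  backward := by
    simp only [StepBound, Allowed]
    intro l m n c' h1 h2 h3 h4 h5 h6
    refine ⟨by grind, by grind, l - max n (m - c'), ?_⟩
    grind
  cross_forward := by simp only [StepBound, Allowed, nextCarry]; grind
  cross_backward := by simp only [StepBound, Allowed]; grind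

theorem IsStrip.stepBound {a : Bool} {lam mu : ℕ → ℕ} (h : IsStrip a lam mu) (k : ℕ) :
    StepBound a (mu k) (lam k) := ⟨(h k).1, (h k).2.1⟩

/-! ### The local rule for partitions -/

/-- The entries that are inserted into the successive rows when a cell is added. -/
def carry (out : ℕ → ℕ → ℕ → ℕ → ℕ) (r m n : ℕ → ℕ) (c : ℕ) : ℕ → ℕ
  | 0 => c
  | k + 1 => nextCarry out (r k) (m k) (n k) (carry out r m n c k)

/-- The partition in the upper right corner of a cell. -/
def addCell (out : ℕ → ℕ → ℕ → ℕ → ℕ) (r m n : ℕ → ℕ) (c k : ℕ) : ℕ :=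
  out (r k) (m k) (n k) (carry out r m n c k)

/-- Downward induction over the rows: inverting a rule starts far out, where everything vanishes. -/
theorem forall_of_eventually_of_succ {P : ℕ → Prop} (N : ℕ) (h0 : ∀ k, N ≤ k → P k)
    (h1 : ∀ k, P (k + 1) → P k) (k : ℕ) : P k := by
  by_cases hk : N ≤ k
  · exact h0 k hk
  · obtain ⟨d, hd⟩ := Nat.exists_eq_add_of_le (not_le.mp hk).le
    have : ∀ d k, N = k + d → P k := by
      intro d
      induction d with
      | zero => intro k hk; exact h0 k (by omega)
      | succ d ih => intro k hk; exact h1 k (ih (k + 1) (by omega))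
    exact this d k hd

theorem IsPartition.eq_zero_of_le {f : ℕ → ℕ} (hf : IsPartition f) {N k : ℕ} (hN : f N = 0)
    (hk : N ≤ k) : f k = 0 := by
  have := hf.antitone hk
  omega

namespace GrowthRule

variable {a b : Bool} (R : GrowthRule a b)

theorem allowed_carry {r m n : ℕ → ℕ} {c : ℕ} (hn : IsStrip a n r) (hm : IsStrip b m r)
    (hc : Allowed a b c) (k : ℕ) : Allowed a b (carry R.out r m n c k) := by
  induction k with
  | zero => exact hc
  | succ k ih => exact (R.forward (hn.stepBound k) (hm.stepBound k) ih).2.2.1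

theorem carry_succ_add {r m n : ℕ → ℕ} {c : ℕ} (hn : IsStrip a n r) (hm : IsStrip b m r)
    (hc : Allowed a b c) (k : ℕ) :
    carry R.out r m n c (k + 1) + addCell R.out r m n c k + r k =
      carry R.out r m n c k + m k + n k :=
  (R.forward (hn.stepBound k) (hm.stepBound k) (R.allowed_carry hn hm hc k)).2.2.2.1

theorem back_addCell {r m n : ℕ → ℕ} {c : ℕ} (hn : IsStrip a n r) (hm : IsStrip b m r)
    (hc : Allowed a b c) (k : ℕ) :
    R.back (addCell R.out r m n c k) (m k) (n k) (carry R.out r m n c (k + 1)) = r k :=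
  (R.forward (hn.stepBound k) (hm.stepBound k) (R.allowed_carry hn hm hc k)).2.2.2.2

theorem addCell_valid {r m n : ℕ → ℕ} {c : ℕ} (hr : IsPartition r) (hpm : IsPartition m)
    (hpn : IsPartition n) (hn : IsStrip a n r) (hm : IsStrip b m r) (hc : Allowed a b c) :
    IsPartition (addCell R.out r m n c) ∧ IsStrip a (addCell R.out r m n c) m ∧
      IsStrip b (addCell R.out r m n c) n := by
  have hall := R.allowed_carry hn hm hc
  have hcross := fun k => R.cross_forward (hn.stepBound k) (hm.stepBound k)
    (hn.stepBound (k + 1)) (hm.stepBound (k + 1)) (hall k) (hr.antitone k.le_succ)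
    (hpm.antitone k.le_succ) (hpn.antitone k.le_succ) (hn k).2.2 (hm k).2.2
  have hlev := fun k => R.forward (hn.stepBound k) (hm.stepBound k) (hall k)
  refine ⟨⟨antitone_nat_of_succ_le fun k => (hcross k).1, ?_⟩,
    fun k => ⟨(hlev k).1.1, (hlev k).1.2, (hcross k).2.1⟩,
    fun k => ⟨(hlev k).2.1.1, (hlev k).2.1.2, (hcross k).2.2⟩⟩
  obtain ⟨M, hM⟩ := hpm.eventually_zero
  obtain ⟨N, hN⟩ := hpn.eventually_zero
  have hz : ∀ k, M + N ≤ k → r k = 0 ∧ m k = 0 ∧ n k = 0 := by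
    intro k hk
    have h1 := hpm.eq_zero_of_le hM (show M ≤ k by omega)
    have h2 := hpn.eq_zero_of_le hN (show N ≤ k by omega)
    have h3 := (hn k).1
    omega
  -- Where `r`, `m` and `n` have run out, a non-zero carry leaves at least one cell in each row and
  -- so decreases strictly.
  have hdec : ∀ d, carry R.out r m n c (M + N + d) ≤ carry R.out r m n c (M + N) - d := by
    intro d
    induction d with
    | zero => simp
    | succ d ih =>
      obtain ⟨h1, h2, h3⟩ := hz (M + N + d) (by omega)
      have hbal := R.carry_succ_add hn hm hc (M + N + d)
      have hout : addCell R.out r m n c (M + N + d) = 0 →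
          carry R.out r m n c (M + N + d) = 0 := by
        unfold addCell
        rw [h1, h2, h3]
        exact R.eq_zero_of_out _
      rw [← add_assoc]
      omega
  refine ⟨M + N + carry R.out r m n c (M + N), ?_⟩
  obtain ⟨h1, h2, h3⟩ := hz (M + N + carry R.out r m n c (M + N)) (by omega)
  have h4 := hdec (carry R.out r m n c (M + N))
  rw [Nat.sub_self, Nat.le_zero] at h4
  rw [addCell, h1, h2, h3, h4, R.out_zero]

/-- Both carries vanish beyond the last row of the common result. From there `back` and the balance
equation recover the lower left partition and the carries, row by row down to row `0`. -/
theorem addCell_injective {r m n r' : ℕ → ℕ} {c c' : ℕ} (hr : IsPartition r)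
    (hpm : IsPartition m) (hpn : IsPartition n) (hn : IsStrip a n r) (hm : IsStrip b m r)
    (hc : Allowed a b c) (hn' : IsStrip a n r') (hm' : IsStrip b m r') (hc' : Allowed a b c')
    (h : addCell R.out r m n c = addCell R.out r' m n c') : r = r' ∧ c = c' := by
  obtain ⟨N, hN⟩ := (R.addCell_valid hr hpm hpn hn hm hc).1.eventually_zero
  have hz : ∀ (s : ℕ → ℕ) (d : ℕ), IsStrip a n s → IsStrip b m s → Allowed a b d →
      addCell R.out r m n c = addCell R.out s m n d → ∀ k, N ≤ k →
      carry R.out s m n d k = 0 := by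
    intro s d hns hms hd hs k hk
    have h0 := (R.addCell_valid hr hpm hpn hn hm hc).1.eq_zero_of_le hN hk
    have h1 := (((R.addCell_valid hr hpm hpn hn hm hc).2.1) k).1
    have h2 := (((R.addCell_valid hr hpm hpn hn hm hc).2.2) k).1
    have h3 := (hns k).1
    rw [hs] at h0
    rw [hs] at h1 h2
    apply R.eq_zero_of_out
    have h4 : s k = 0 ∧ m k = 0 ∧ n k = 0 := by omega
    rw [addCell, h4.1, h4.2.1, h4.2.2] at h0
    exact h0
  have hcarry := forall_of_eventually_of_succ
    (P := fun k => carry R.out r m n c k = carry R.out r' m n c' k) N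
    (fun k hk => by rw [hz r c hn hm hc rfl k hk, hz r' c' hn' hm' hc' h k hk])
    (fun k hk => by
      have h1 := R.carry_succ_add hn hm hc k
      have h2 := R.carry_succ_add hn' hm' hc' k
      have h3 := R.back_addCell hn hm hc k
      have h4 := R.back_addCell hn' hm' hc' k
      rw [← h, ← hk] at h2 h4
      omega)
  refine ⟨funext fun k => ?_, hcarry 0⟩
  rw [← R.back_addCell hn hm hc k, ← R.back_addCell hn' hm' hc' k, ← h, hcarry]

/-- The inverse rule is run from the empty rows to row `0`; the carry that arrives there is the
entry of the cell. -/
theorem exists_addCell {l m n : ℕ → ℕ} (hl : IsPartition l) (hpm : IsPartition m)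
    (hpn : IsPartition n) (hm : IsStrip a l m) (hn : IsStrip b l n) :
    ∃ (r : ℕ → ℕ) (c : ℕ), IsPartition r ∧ IsStrip a n r ∧ IsStrip b m r ∧ Allowed a b c ∧
      addCell R.out r m n c = l := by
  obtain ⟨N, hN⟩ := hl.eventually_zero
  have hz : ∀ k, N ≤ k → l k = 0 ∧ m k = 0 ∧ n k = 0 := by
    intro k hk
    have h1 := hl.eq_zero_of_le hN hk
    have h2 := (hm k).1
    have h3 := (hn k).1
    omega
  -- `d j` is the carry entering row `N - j`: reversing the index makes the descending recursion
  -- primitive.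
  let d : ℕ → ℕ := fun j => Nat.rec 0 (fun j x => x + l (N - 1 - j) +
    R.back (l (N - 1 - j)) (m (N - 1 - j)) (n (N - 1 - j)) x -
      (m (N - 1 - j) + n (N - 1 - j))) j
  let e : ℕ → ℕ := fun k => d (N - k)
  have he0 : ∀ k, N ≤ k → e k = 0 := by
    intro k hk
    have : N - k = 0 := by omega
    simp only [e, this]
    rfl
  have hes : ∀ k, e k = e (k + 1) + l k + R.back (l k) (m k) (n k) (e (k + 1)) - (m k + n k) := by
    intro k
    by_cases hk : N ≤ k
    · obtain ⟨h1, h2, h3⟩ := hz k hk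
      rw [he0 k hk, he0 (k + 1) (by omega), h1, h2, h3, R.back_zero]
    · obtain ⟨j, hj⟩ : ∃ j, N - k = j + 1 := ⟨N - k - 1, by omega⟩
      have h1 : N - (k + 1) = j := by omega
      have h2 : N - 1 - j = k := by omega
      have h3 : e k = d (j + 1) := by simp only [e, hj]
      have h4 : e (k + 1) = d j := by simp only [e, h1]
      rw [h3, h4, ← h2]
  have hinv := forall_of_eventually_of_succ
    (P := fun k => Allowed a b (e k) ∧ (a = false ∨ b = false → e k ≤ l k) ∧
      (0 < e k → 0 < l k)) N
    (fun k hk => by simp [he0 k hk, Allowed])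
    (fun k ⟨h1, h2, h3⟩ => by
      have hla := hl.antitone k.le_succ
      obtain ⟨-, -, c, hc1, hc2, hc3, hc4, -⟩ := R.backward (hm.stepBound k) (hn.stepBound k) h1
        (fun ha => (h2 (Or.inl ha)).trans ((hm k).2.2 ha))
        (fun hb => (h2 (Or.inr hb)).trans ((hn k).2.2 hb)) (fun h => (h3 h).trans_le hla)
      have : e k = c := by
        have := hes k
        omega
      rw [this]
      exact ⟨hc2, hc3, hc4⟩)
  set r : ℕ → ℕ := fun k => R.back (l k) (m k) (n k) (e (k + 1)) with hr
  have hlev : ∀ k, StepBound a (r k) (n k) ∧ StepBound b (r k) (m k) ∧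
      e k + m k + n k = e (k + 1) + l k + r k ∧ R.out (r k) (m k) (n k) (e k) = l k := by
    intro k
    obtain ⟨h1, h2, h3⟩ := hinv (k + 1)
    have hla := hl.antitone k.le_succ
    obtain ⟨hb1, hb2, c, hc1, hc2, hc3, hc4, hc5⟩ := R.backward (hm.stepBound k)
      (hn.stepBound k) h1
      (fun ha => (h2 (Or.inl ha)).trans ((hm k).2.2 ha))
      (fun hb => (h2 (Or.inr hb)).trans ((hn k).2.2 hb)) (fun h => (h3 h).trans_le hla)
    have : e k = c := by
      have := hes k
      omega
    exact ⟨hb1, hb2, by rw [this]; exact hc1, by rw [this]; exact hc5⟩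
  have hcross : ∀ k, r (k + 1) ≤ r k ∧ (a = false → n (k + 1) ≤ r k) ∧
      (b = false → m (k + 1) ≤ r k) := by
    intro k
    obtain ⟨h1, h2, h3⟩ := hinv (k + 2)
    have hla := hl.antitone (k + 1).le_succ
    exact R.cross_backward (hm.stepBound k) (hn.stepBound k) (hm.stepBound (k + 1))
      (hn.stepBound (k + 1)) (hl.antitone k.le_succ) (hpm.antitone k.le_succ)
      (hpn.antitone k.le_succ) (hm k).2.2 (hn k).2.2 (hinv (k + 1)).1 h1
      (fun ha => (h2 (Or.inl ha)).trans ((hm (k + 1)).2.2 ha))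
      (fun hb => (h2 (Or.inr hb)).trans ((hn (k + 1)).2.2 hb))
      (fun h => (h3 h).trans_le hla) (hlev (k + 1)).2.2.1
  have hcarry : ∀ k, carry R.out r m n (e 0) k = e k := by
    intro k
    induction k with
    | zero => rfl
    | succ k ih =>
      rw [carry, ih, nextCarry, (hlev k).2.2.2]
      have := (hlev k).2.2.1
      omega
  refine ⟨r, e 0, ⟨antitone_nat_of_succ_le fun k => (hcross k).1, N, ?_⟩,
    fun k => ⟨(hlev k).1.1, (hlev k).1.2, (hcross k).2.1⟩,
    fun k => ⟨(hlev k).2.1.1, (hlev k).2.1.2, (hcross k).2.2⟩, (hinv 0).1, ?_⟩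
  · have h1 := (hlev N).1.1
    have h2 := (hz N le_rfl).2.2
    omega
  · funext k
    rw [addCell, hcarry, (hlev k).2.2.2]

end GrowthRule

/-! ### Growth diagrams -/

/-- The growth of the first row lengths. -/
def growth (out : ℕ → ℕ → ℕ → ℕ → ℕ) (m : ℕ → ℕ → ℕ) : ℕ → ℕ → ℕ
  | 0, _ => 0
  | _ + 1, 0 => 0
  | i + 1, j + 1 => out (growth out m i j) (growth out m i (j + 1)) (growth out m (i + 1) j) (m i j)
termination_by i j => (i, j)

/-- The filling that governs the growth of the second row lengths. -/
def derived (out : ℕ → ℕ → ℕ → ℕ → ℕ) (m : ℕ → ℕ → ℕ) (i j : ℕ) : ℕ :=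
  nextCarry out (growth out m i j) (growth out m i (j + 1)) (growth out m (i + 1) j) (m i j)

/-- The partition at the lattice point `(i, j)` of the growth diagram of `m`. -/
def shape (out : ℕ → ℕ → ℕ → ℕ → ℕ) (m : ℕ → ℕ → ℕ) (i j k : ℕ) : ℕ :=
  growth out ((derived out)^[k] m) i j

section growth

variable {out : ℕ → ℕ → ℕ → ℕ → ℕ} {m m' : ℕ → ℕ → ℕ}

@[simp] theorem growth_zero_left (j : ℕ) : growth out m 0 j = 0 := by
  rw [growth]

@[simp] theorem growth_zero_right (i : ℕ) : growth out m i 0 = 0 := by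
  cases i <;> rw [growth]

theorem growth_succ_succ (i j : ℕ) : growth out m (i + 1) (j + 1) =
    out (growth out m i j) (growth out m i (j + 1)) (growth out m (i + 1) j) (m i j) := by
  rw [growth]

theorem shape_zero_left (j : ℕ) : shape out m 0 j = 0 := by
  funext k
  simp [shape]

theorem shape_zero_right (i : ℕ) : shape out m i 0 = 0 := by
  funext k
  simp [shape]

theorem shape_succ (i j k : ℕ) : shape out m i j (k + 1) = shape out (derived out m) i j k := rfl

/-- The computation can be ordered by rows of the partitions (the whole diagram, then the derived
one) or by cells (all rows at once). The two orders agree, so `shape` obeys the local rule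
`addCell`. -/
theorem iterate_derived (i j k : ℕ) : ((derived out)^[k] m) i j =
    carry out (shape out m i j) (shape out m i (j + 1)) (shape out m (i + 1) j) (m i j) k := by
  induction k with
  | zero => rfl
  | succ k ih => rw [Function.iterate_succ_apply', carry, ← ih]; rfl

theorem shape_succ_succ (i j : ℕ) : shape out m (i + 1) (j + 1) =
    addCell out (shape out m i j) (shape out m i (j + 1)) (shape out m (i + 1) j) (m i j) := by
  funext k
  rw [addCell, ← iterate_derived, shape, growth_succ_succ]
  rfl

theorem growth_congr {p q : ℕ} (h : ∀ i j, i < p → j < q → m i j = m' i j) :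
    ∀ i j, i ≤ p → j ≤ q → growth out m i j = growth out m' i j := by
  intro i
  induction i with
  | zero => simp
  | succ i ihi =>
    intro j
    induction j with
    | zero => simp
    | succ j ihj =>
      intro hi hj
      rw [growth_succ_succ, growth_succ_succ, ihi _ (by omega) (by omega),
        ihi _ (by omega) (by omega), ihj (by omega) (by omega), h i j (by omega) (by omega)]

theorem shape_congr {p q : ℕ} (h : ∀ i j, i < p → j < q → m i j = m' i j) :
    shape out m p q = shape out m' p q := by
  funext k
  have : ∀ i j, i < p → j < q → ((derived out)^[k] m) i j = ((derived out)^[k] m') i j := by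
    induction k with
    | zero => exact h
    | succ k ih =>
      intro i j hi hj
      rw [Function.iterate_succ_apply', Function.iterate_succ_apply', derived, derived,
        growth_congr ih _ _ (by omega) (by omega), growth_congr ih _ _ (by omega) (by omega),
        growth_congr ih _ _ (by omega) (by omega), ih _ _ hi hj]
  exact growth_congr this p q le_rfl le_rfl

end growth

namespace GrowthRule

variable {a b : Bool} (R : GrowthRule a b)

/-- The upper and right edges of a cell are the lower and left edges of its neighbours, so the
double induction carries all the strips around a cell. -/
theorem shape_valid {m : ℕ → ℕ → ℕ} (hm : ∀ i j, Allowed a b (m i j)) (i : ℕ) :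
    ∀ j, IsPartition (shape R.out m i j) ∧ IsPartition (shape R.out m (i + 1) j) ∧
      IsStrip a (shape R.out m (i + 1) j) (shape R.out m i j) ∧
      IsStrip b (shape R.out m i (j + 1)) (shape R.out m i j) ∧
      IsStrip b (shape R.out m (i + 1) (j + 1)) (shape R.out m (i + 1) j) := by
  induction i with
  | zero =>
    intro j
    induction j with
    | zero =>
      have := R.addCell_valid .zero .zero .zero (.zero a) (.zero b) (hm 0 0)
      refine ⟨?_, ?_, ?_, ?_, ?_⟩
      all_goals simp only [shape_zero_left, shape_zero_right, shape_succ_succ]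
      · exact .zero
      · exact .zero
      · exact .zero a
      · exact .zero b
      · exact this.2.2
    | succ j ih =>
      rw [shape_zero_left] at ih ⊢
      have h0 := R.addCell_valid .zero .zero ih.2.1 ih.2.2.1 (.zero b) (hm 0 j)
      have h1 : shape R.out m (0 + 1) (j + 1) = addCell R.out 0 0 (shape R.out m (0 + 1) j)
          (m 0 j) := by rw [shape_succ_succ, shape_zero_left, shape_zero_left]
      rw [← h1] at h0
      have h2 := R.addCell_valid .zero .zero h0.1 h0.2.1 (.zero b) (hm 0 (j + 1))
      have h3 : shape R.out m (0 + 1) (j + 1 + 1) = addCell R.out 0 0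
          (shape R.out m (0 + 1) (j + 1)) (m 0 (j + 1)) := by
        rw [shape_succ_succ, shape_zero_left, shape_zero_left]
      rw [← h3] at h2
      exact ⟨.zero, h0.1, h0.2.1, by rw [shape_zero_left]; exact .zero b, h2.2.2⟩
  | succ i ihi =>
    have key : ∀ j, IsPartition (shape R.out m (i + 1 + 1) j) ∧
        IsStrip a (shape R.out m (i + 1 + 1) j) (shape R.out m (i + 1) j) ∧
        IsStrip b (shape R.out m (i + 1 + 1) (j + 1)) (shape R.out m (i + 1 + 1) j) := by
      intro j
      induction j with
      | zero =>
        have := R.addCell_valid (ihi 0).2.1 (ihi 1).2.1 .zero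
          (by rw [shape_zero_right]; exact .zero a) (ihi 0).2.2.2.2 (hm (i + 1) 0)
        rw [shape_succ_succ, shape_zero_right (i + 1 + 1)]
        refine ⟨.zero, ?_, this.2.2⟩
        rw [shape_zero_right]
        exact .zero a
      | succ j ih =>
        have h0 := R.addCell_valid (ihi j).2.1 (ihi (j + 1)).2.1 ih.1 ih.2.1 (ihi j).2.2.2.2
          (hm (i + 1) j)
        rw [← shape_succ_succ] at h0
        have h1 := R.addCell_valid (ihi (j + 1)).2.1 (ihi (j + 1 + 1)).2.1 h0.1 h0.2.1
          (ihi (j + 1)).2.2.2.2 (hm (i + 1) (j + 1))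
        rw [← shape_succ_succ] at h1
        exact ⟨h0.1, h0.2.1, h1.2.2⟩
    intro j
    exact ⟨(ihi j).2.1, (key j).1, (key j).2.1, (ihi j).2.2.2.2, (key j).2.2⟩

end GrowthRule

/-! ### Fillings of a Ferrers shape and the partitions along its boundary -/

/-- The lattice points on the outer boundary of `F`. -/
def OnBoundary (F : Finset (ℕ × ℕ)) (i j : ℕ) : Prop :=
  (i, j) ∉ F ∧ ∀ i' j', i = i' + 1 → j = j' + 1 → (i', j') ∈ F

/-- The sequences of partitions along the boundary of `F` that belong to fillings of `F`. -/
structure IsBoundaryData (a b : Bool) (F : Finset (ℕ × ℕ)) (w : ℕ → ℕ → ℕ → ℕ) : Prop where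
  isPartition : ∀ i j, OnBoundary F i j → IsPartition (w i j)
  zero_left : ∀ j, OnBoundary F 0 j → w 0 j = 0
  zero_right : ∀ i, OnBoundary F i 0 → w i 0 = 0
  vert : ∀ i j, OnBoundary F i j → OnBoundary F (i + 1) j → IsStrip a (w (i + 1) j) (w i j)
  horiz : ∀ i j, OnBoundary F i j → OnBoundary F i (j + 1) → IsStrip b (w i (j + 1)) (w i j)

theorem conj_zero : conj 0 = 0 := by
  funext k
  by_contra h
  have := IsPartition.zero.lt_conj.mp (Nat.pos_of_ne_zero h)
  simp at this

theorem IsBoundaryData.conj {a b : Bool} {F : Finset (ℕ × ℕ)} {w : ℕ → ℕ → ℕ → ℕ}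
    (h : IsBoundaryData a b F w) : IsBoundaryData (!a) (!b) F fun i j => conj (w i j) where
  isPartition i j hij := (h.isPartition i j hij).conj
  zero_left j hj := by rw [h.zero_left j hj, conj_zero]
  zero_right i hi := by rw [h.zero_right i hi, conj_zero]
  vert i j h1 h2 := (h.vert i j h1 h2).conj (h.isPartition _ _ h2) (h.isPartition _ _ h1)
  horiz i j h1 h2 := (h.horiz i j h1 h2).conj (h.isPartition _ _ h2) (h.isPartition _ _ h1)

/-- The fillings of `F`. -/
structure IsFillingOf (a b : Bool) (F : Finset (ℕ × ℕ)) (m : ℕ → ℕ → ℕ) : Prop where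
  support : ∀ i j, (i, j) ∉ F → m i j = 0
  allowed : ∀ i j, Allowed a b (m i j)

theorem IsFillingOf.isBoundaryData {a b : Bool} {F : Finset (ℕ × ℕ)} {m : ℕ → ℕ → ℕ}
    (h : IsFillingOf a b F m) (R : GrowthRule a b) : IsBoundaryData a b F (shape R.out m) where
  isPartition i j _ := (R.shape_valid h.allowed i j).1
  zero_left j _ := shape_zero_left j
  zero_right i _ := shape_zero_right i
  vert i j _ _ := (R.shape_valid h.allowed i j).2.2.1
  horiz i j _ _ := (R.shape_valid h.allowed i j).2.2.2.1

/-- `(i, j)` is a corner of `F`. -/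
structure IsCorner (F : Finset (ℕ × ℕ)) (i j : ℕ) : Prop where
  lower : IsLowerSet (F : Set (ℕ × ℕ))
  mem : (i, j) ∈ F
  up : (i + 1, j) ∉ F
  right : (i, j + 1) ∉ F

theorem exists_isCorner {F : Finset (ℕ × ℕ)} (hF : IsLowerSet (F : Set (ℕ × ℕ)))
    (hne : F.Nonempty) : ∃ i j, IsCorner F i j := by
  obtain ⟨⟨i, j⟩, hc, hmax⟩ := F.exists_max_image (fun c => c.1 + c.2) hne
  refine ⟨i, j, hF, hc, fun h => ?_, fun h => ?_⟩
  · have := hmax _ h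
    simp only at this
    omega
  · have := hmax _ h
    simp only at this
    omega

namespace IsCorner

variable {F : Finset (ℕ × ℕ)} {i j : ℕ} (h : IsCorner F i j)
include h

theorem mem_of_le {p q p' q' : ℕ} (hm : (p, q) ∈ F) (hp : p' ≤ p) (hq : q' ≤ q) :
    (p', q') ∈ F :=
  h.lower (show ((p', q') : ℕ × ℕ) ≤ (p, q) from ⟨hp, hq⟩) hm

theorem eq_of_mem {p q : ℕ} (hm : (p, q) ∈ F) (hp : i ≤ p) (hq : j ≤ q) : p = i ∧ q = j := by
  constructor
  · by_contra hne
    exact h.up (h.mem_of_le hm (by omega) hq)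
  · by_contra hne
    exact h.right (h.mem_of_le hm hp (by omega))

theorem lower_erase : IsLowerSet ((F.erase (i, j) : Finset (ℕ × ℕ)) : Set (ℕ × ℕ)) := by
  rintro ⟨p, q⟩ ⟨p', q'⟩ ⟨h1, h2⟩ hm
  simp only [Finset.coe_erase, Set.mem_sdiff, Finset.mem_coe, Set.mem_singleton_iff,
    Prod.mk.injEq] at hm ⊢
  simp only at h1 h2
  refine ⟨h.mem_of_le hm.1 h1 h2, fun he => hm.2 ?_⟩
  exact h.eq_of_mem hm.1 (by omega) (by omega)

theorem onBoundary_erase : OnBoundary (F.erase (i, j)) i j := by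
  refine ⟨by simp, fun i' j' hi hj => Finset.mem_erase.mpr ⟨?_, ?_⟩⟩
  · simp only [ne_eq, Prod.mk.injEq]
    omega
  · exact h.mem_of_le h.mem (by omega) (by omega)

/-- Erasing the corner replaces the boundary point `(i + 1, j + 1)` by `(i, j)` and alters no other.
The partitions at the remaining points do not depend on the entry of the corner. -/
theorem onBoundary_of_erase {p q : ℕ} (hpq : OnBoundary (F.erase (i, j)) p q)
    (hne : ¬(p = i ∧ q = j)) : OnBoundary F p q ∧ ¬(i < p ∧ j < q) := by
  refine ⟨⟨fun hm => hpq.1 (Finset.mem_erase.mpr ⟨by simpa using hne, hm⟩),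
    fun i' j' hi hj => Finset.mem_of_mem_erase (hpq.2 i' j' hi hj)⟩, ?_⟩
  rintro ⟨h1, h2⟩
  obtain ⟨h3, h4⟩ := Finset.mem_erase.mp (hpq.2 (p - 1) (q - 1) (by omega) (by omega))
  have := h.eq_of_mem h4 (by omega) (by omega)
  exact h3 (by rw [this.1, this.2])

theorem erase_of_onBoundary {p q : ℕ} (hpq : OnBoundary F p q) (hne : ¬(p = i + 1 ∧ q = j + 1)) :
    OnBoundary (F.erase (i, j)) p q ∧ ¬(p = i ∧ q = j) ∧ ¬(i < p ∧ j < q) := by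
  refine ⟨⟨fun hm => hpq.1 (Finset.mem_of_mem_erase hm), fun i' j' hi hj =>
    Finset.mem_erase.mpr ⟨?_, hpq.2 i' j' hi hj⟩⟩, ?_, ?_⟩
  · simp only [ne_eq, Prod.mk.injEq]
    omega
  · rintro ⟨rfl, rfl⟩
    exact hpq.1 h.mem
  · rintro ⟨h1, h2⟩
    have := h.eq_of_mem (hpq.2 (p - 1) (q - 1) (by omega) (by omega)) (by omega) (by omega)
    omega

theorem onBoundary_up : OnBoundary F (i + 1) j :=
  ⟨h.up, fun _ _ _ _ => h.mem_of_le h.mem (by omega) (by omega)⟩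

theorem onBoundary_right : OnBoundary F i (j + 1) :=
  ⟨h.right, fun _ _ _ _ => h.mem_of_le h.mem (by omega) (by omega)⟩

theorem onBoundary_diag : OnBoundary F (i + 1) (j + 1) :=
  ⟨fun hm => h.up (h.mem_of_le hm le_rfl (by omega)),
    fun _ _ _ _ => h.mem_of_le h.mem (by omega) (by omega)⟩

end IsCorner

namespace GrowthRule

variable {a b : Bool} (R : GrowthRule a b)

/-- At a corner, three boundary partitions determine the fourth one and the entry by
`addCell_injective`; erase the corner and induct. -/
theorem filling_unique {F : Finset (ℕ × ℕ)} (hF : IsLowerSet (F : Set (ℕ × ℕ)))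
    {m m' : ℕ → ℕ → ℕ} (hm : IsFillingOf a b F m) (hm' : IsFillingOf a b F m')
    (h : ∀ i j, OnBoundary F i j → shape R.out m i j = shape R.out m' i j) : m = m' := by
  induction hk : F.card generalizing F m m' with
  | zero =>
    rw [Finset.card_eq_zero] at hk
    subst hk
    funext i j
    rw [hm.support i j (by simp), hm'.support i j (by simp)]
  | succ d ih =>
    obtain ⟨i, j, hc⟩ := exists_isCorner hF (Finset.card_pos.mp (by omega))
    have hclear : ∀ {x : ℕ → ℕ → ℕ}, IsFillingOf a b F x →
        IsFillingOf a b (F.erase (i, j)) fun p q => if p = i ∧ q = j then 0 else x p q := by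
      intro x hx
      refine ⟨fun p q hpq => ?_, fun p q => ?_⟩
      · by_cases hp : p = i ∧ q = j
        · simp [hp]
        · simp only [hp, if_false]
          exact hx.support p q fun hmem => hpq (Finset.mem_erase.mpr ⟨by simpa using hp, hmem⟩)
      · by_cases hp : p = i ∧ q = j
        · simp [hp, Allowed]
        · simp only [hp, if_false]
          exact hx.allowed p q
    have hloc : ∀ (x : ℕ → ℕ → ℕ) (p q : ℕ), ¬(i < p ∧ j < q) →
        shape R.out (fun p q => if p = i ∧ q = j then 0 else x p q) p q = shape R.out x p q := by
      intro x p q hpq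
      refine shape_congr fun u v hu hv => ?_
      rw [if_neg]
      omega
    have hin : shape R.out m i j = shape R.out m' i j ∧ m i j = m' i j := by
      have e1 := h _ _ hc.onBoundary_diag
      have e2 := h _ _ hc.onBoundary_up
      have e3 := h _ _ hc.onBoundary_right
      have v := R.shape_valid hm.allowed i
      have v' := R.shape_valid hm'.allowed i
      rw [shape_succ_succ, shape_succ_succ, ← e2, ← e3] at e1
      refine R.addCell_injective (v j).1 (v (j + 1)).1 (v j).2.1 (v j).2.2.1 (v j).2.2.2.1
        (hm.allowed i j) ?_ ?_ (hm'.allowed i j) e1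
      · rw [e2]; exact (v' j).2.2.1
      · rw [e3]; exact (v' j).2.2.2.1
    have key := ih hc.lower_erase (hclear hm) (hclear hm') (fun p q hpq => by
      by_cases hp : p = i ∧ q = j
      · rw [hp.1, hp.2, hloc _ _ _ (by omega), hloc _ _ _ (by omega)]
        exact hin.1
      · obtain ⟨h1, h2⟩ := hc.onBoundary_of_erase hpq hp
        rw [hloc _ _ _ h2, hloc _ _ _ h2]
        exact h p q h1) (by rw [Finset.card_erase_of_mem hc.mem]; omega)
    funext p q
    by_cases hp : p = i ∧ q = j
    · rw [hp.1, hp.2]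
      exact hin.2
    · have := congrFun (congrFun key p) q
      simpa only [hp, if_false] using this

/-- At a corner, `exists_addCell` supplies the inner partition and the entry, which gives boundary
data for the shape without the corner. -/
theorem exists_filling {F : Finset (ℕ × ℕ)} (hF : IsLowerSet (F : Set (ℕ × ℕ)))
    {w : ℕ → ℕ → ℕ → ℕ} (hw : IsBoundaryData a b F w) :
    ∃ m, IsFillingOf a b F m ∧ ∀ i j, OnBoundary F i j → shape R.out m i j = w i j := by
  induction hk : F.card generalizing F w with
  | zero =>
    rw [Finset.card_eq_zero] at hk
    subst hk
    refine ⟨fun _ _ => 0, ⟨fun _ _ _ => rfl, fun _ _ => by simp [Allowed]⟩, fun i j hij => ?_⟩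
    -- Without cells, every boundary point lies on an axis.
    cases i with
    | zero => rw [shape_zero_left, hw.zero_left j hij]
    | succ i =>
      cases j with
      | zero => rw [shape_zero_right, hw.zero_right _ hij]
      | succ j => exact absurd (hij.2 i j rfl rfl) (by simp)
  | succ d ih =>
    obtain ⟨i, j, hc⟩ := exists_isCorner hF (Finset.card_pos.mp (by omega))
    obtain ⟨r, c, hr, hrv, hrh, hac, hadd⟩ := R.exists_addCell
      (hw.isPartition _ _ hc.onBoundary_diag) (hw.isPartition _ _ hc.onBoundary_right)
      (hw.isPartition _ _ hc.onBoundary_up)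
      (hw.vert _ _ hc.onBoundary_right hc.onBoundary_diag)
      (hw.horiz _ _ hc.onBoundary_up hc.onBoundary_diag)
    have hw' : IsBoundaryData a b (F.erase (i, j))
        fun p q => if p = i ∧ q = j then r else w p q := by
      refine ⟨fun p q hpq => ?_, fun q hq => ?_, fun p hp => ?_, fun p q h1 h2 => ?_,
        fun p q h1 h2 => ?_⟩
      · split_ifs with hp
        · exact hr
        · exact hw.isPartition _ _ (hc.onBoundary_of_erase hpq hp).1
      · split_ifs with hp
        · funext k
          have h1 := (hrh k).1
          rw [← hp.1, hw.zero_left _ (by rw [hp.1]; exact hc.onBoundary_right)] at h1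
          exact Nat.le_zero.mp h1
        · exact hw.zero_left _ (hc.onBoundary_of_erase hq hp).1
      · split_ifs with hq
        · funext k
          have h1 := (hrv k).1
          rw [← hq.2, hw.zero_right _ (by rw [hq.2]; exact hc.onBoundary_up)] at h1
          exact Nat.le_zero.mp h1
        · exact hw.zero_right _ (hc.onBoundary_of_erase hp hq).1
      · by_cases hp : p = i ∧ q = j
        · rw [if_pos hp, if_neg (by omega), hp.1, hp.2]
          exact hrv
        · by_cases hp' : p + 1 = i ∧ q = j
          · exfalso
            refine h1.1 (Finset.mem_erase.mpr ⟨by simpa using hp, ?_⟩)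
            exact hc.mem_of_le hc.mem (by omega) (by omega)
          · rw [if_neg hp, if_neg hp']
            exact hw.vert _ _ (hc.onBoundary_of_erase h1 hp).1 (hc.onBoundary_of_erase h2 hp').1
      · by_cases hp : p = i ∧ q = j
        · rw [if_pos hp, if_neg (by omega), hp.1, hp.2]
          exact hrh
        · by_cases hp' : p = i ∧ q + 1 = j
          · exfalso
            refine h1.1 (Finset.mem_erase.mpr ⟨by simpa using hp, ?_⟩)
            exact hc.mem_of_le hc.mem (by omega) (by omega)
          · rw [if_neg hp, if_neg hp']
            exact hw.horiz _ _ (hc.onBoundary_of_erase h1 hp).1 (hc.onBoundary_of_erase h2 hp').1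
    obtain ⟨m, hm, hmw⟩ := ih hc.lower_erase hw'
      (by rw [Finset.card_erase_of_mem hc.mem]; omega)
    have hloc : ∀ p q, ¬(i < p ∧ j < q) →
        shape R.out (fun p q => if p = i ∧ q = j then c else m p q) p q = shape R.out m p q := by
      intro p q hpq
      refine shape_congr fun u v hu hv => ?_
      rw [if_neg]
      omega
    refine ⟨fun p q => if p = i ∧ q = j then c else m p q, ⟨fun p q hpq => ?_, fun p q => ?_⟩,
      fun p q hpq => ?_⟩
    · have hp : ¬(p = i ∧ q = j) := by
        rintro ⟨rfl, rfl⟩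
        exact hpq hc.mem
      simp only [hp, if_false]
      exact hm.support p q fun hmem => hpq (Finset.mem_of_mem_erase hmem)
    · by_cases hp : p = i ∧ q = j
      · simp only [hp, and_self, if_true]
        exact hac
      · simp only [hp, if_false]
        exact hm.allowed p q
    · by_cases hp : p = i + 1 ∧ q = j + 1
      · have hv := hc.erase_of_onBoundary hc.onBoundary_up (by omega)
        have hh := hc.erase_of_onBoundary hc.onBoundary_right (by omega)
        rw [hp.1, hp.2, shape_succ_succ, hloc _ _ (by omega), hloc _ _ (by omega),
          hloc _ _ (by omega), hmw _ _ hv.1, hmw _ _ hh.1, hmw _ _ hc.onBoundary_erase,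
          if_neg hv.2.1, if_neg hh.2.1]
        simp only [and_self, if_true]
        exact hadd
      · obtain ⟨h1, h2, h3⟩ := hc.erase_of_onBoundary hpq hp
        rw [hloc _ _ h3, hmw _ _ h1, if_neg h2]

end GrowthRule

/-! ### Chains -/

/-- `q` lies to the north-east of `p`, strictly in the vertical direction if `a`, and strictly in
the horizontal direction if `b`. -/
def IsFwd (a b : Bool) (p q : ℕ × ℕ) : Prop :=
  p ≠ q ∧ p.1 ≤ q.1 ∧ p.2 ≤ q.2 ∧ (a = true → p.1 ≠ q.1) ∧ (b = true → p.2 ≠ q.2)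

/-- `q` lies to the south-east of `p`, strictly in the vertical direction if `a`, and strictly in
the horizontal direction if `b`. -/
def IsBwd (a b : Bool) (p q : ℕ × ℕ) : Prop :=
  p ≠ q ∧ q.1 ≤ p.1 ∧ p.2 ≤ q.2 ∧ (a = true → p.1 ≠ q.1) ∧ (b = true → p.2 ≠ q.2)

/-- The length of a chain. -/
def chainValue (a b : Bool) (m : ℕ → ℕ → ℕ) (l : List (ℕ × ℕ)) : ℕ :=
  (l.map fun c => weight a b (m c.1 c.2)).sum

/-- `l` is a chain of non-zero entries in the rectangle `[0, I) × [0, J)`. -/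
def IsRectChain (Rel : ℕ × ℕ → ℕ × ℕ → Prop) (m : ℕ → ℕ → ℕ) (I J : ℕ) (l : List (ℕ × ℕ)) : Prop :=
  l.Pairwise Rel ∧ ∀ c ∈ l, c.1 < I ∧ c.2 < J ∧ m c.1 c.2 ≠ 0

/-- The lengths of the chains in the rectangle `[0, I) × [0, J)`. -/
def chainLengths (Rel : ℕ × ℕ → ℕ × ℕ → Prop) (a b : Bool) (m : ℕ → ℕ → ℕ) (I J : ℕ) : Set ℕ :=
  {d | ∃ l, IsRectChain Rel m I J l ∧ chainValue a b m l = d}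

@[simp] theorem chainValue_nil (a b : Bool) (m : ℕ → ℕ → ℕ) : chainValue a b m [] = 0 := rfl

@[simp] theorem chainValue_cons (a b : Bool) (m : ℕ → ℕ → ℕ) (c : ℕ × ℕ) (l : List (ℕ × ℕ)) :
    chainValue a b m (c :: l) = weight a b (m c.1 c.2) + chainValue a b m l := by
  simp [chainValue]

theorem chainValue_reverse (a b : Bool) (m : ℕ → ℕ → ℕ) (l : List (ℕ × ℕ)) :
    chainValue a b m l.reverse = chainValue a b m l := by
  simp [chainValue, List.sum_reverse]

theorem weight_eq_zero {a b : Bool} {c : ℕ} : weight a b c = 0 ↔ c = 0 := by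
  unfold weight
  split_ifs <;> omega

namespace GrowthRule

variable {a b : Bool} (R : GrowthRule a b)

section

variable {m : ℕ → ℕ → ℕ} (hm : ∀ i j, Allowed a b (m i j))
include hm

theorem growth_stepBound (i j : ℕ) :
    StepBound a (growth R.out m i j) (growth R.out m (i + 1) j) ∧
      StepBound b (growth R.out m i j) (growth R.out m i (j + 1)) :=
  ⟨(R.shape_valid hm i j).2.2.1.stepBound 0, (R.shape_valid hm i j).2.2.2.1.stepBound 0⟩

theorem growth_mono {i j i' j' : ℕ} (hi : i ≤ i') (hj : j ≤ j') :
    growth R.out m i j ≤ growth R.out m i' j' :=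
  (monotone_nat_of_le_succ (f := fun i => growth R.out m i j)
    (fun k => (R.growth_stepBound hm k j).1.1) hi).trans
  (monotone_nat_of_le_succ (f := fun j => growth R.out m i' j)
    (fun k => (R.growth_stepBound hm i' k).2.1) hj)

theorem allowed_derived (i j : ℕ) : Allowed a b (derived R.out m i j) :=
  (R.forward (R.growth_stepBound hm i j).1 (R.growth_stepBound hm i j).2 (hm i j)).2.2.1

theorem derived_add (i j : ℕ) :
    derived R.out m i j + growth R.out m (i + 1) (j + 1) + growth R.out m i j =
      m i j + growth R.out m i (j + 1) + growth R.out m (i + 1) j := by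
  rw [growth_succ_succ]
  exact (R.forward (R.growth_stepBound hm i j).1 (R.growth_stepBound hm i j).2 (hm i j)).2.2.2.1

theorem growth_succ_succ_eq (i j : ℕ) : growth R.out m (i + 1) (j + 1) =
    max (max (growth R.out m i (j + 1)) (growth R.out m (i + 1) j))
      (base a b (growth R.out m i j) (growth R.out m i (j + 1)) (growth R.out m (i + 1) j) +
        weight a b (m i j)) := by
  rw [growth_succ_succ, R.out_eq (hm i j)]

/-- The list starts with the last cell of the chain. All other cells lie in a rectangle whose growth
is accounted for by `base`; for chains weak in both directions, the penultimate cell decides between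
the two rectangles. -/
theorem chainValue_le_growth (l : List (ℕ × ℕ)) :
    ∀ I J, IsRectChain (fun p q => IsFwd a b q p) m I J l →
      chainValue a b m l ≤ growth R.out m I J := by
  induction l with
  | nil => simp
  | cons c l ih =>
    rintro I J ⟨h1, h2⟩
    rw [List.pairwise_cons] at h1
    simp only [List.mem_cons, forall_eq_or_imp] at h2
    obtain ⟨⟨hI, hJ, -⟩, h2⟩ := h2
    refine le_trans ?_ (R.growth_mono hm (show c.1 + 1 ≤ I from hI) (show c.2 + 1 ≤ J from hJ))
    rw [R.growth_succ_succ_eq hm, chainValue_cons, add_comm]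
    refine le_trans (Nat.add_le_add_right ?_ _) (le_max_right _ _)
    have hrect : ∀ I' J', (∀ x ∈ l, x.1 < I' ∧ x.2 < J') →
        chainValue a b m l ≤ growth R.out m I' J' := fun I' J' h =>
      ih I' J' ⟨h1.2, fun x hx => ⟨(h x hx).1, (h x hx).2, (h2 x hx).2.2⟩⟩
    have hl : ∀ x ∈ l, IsFwd a b x c := h1.1
    unfold IsFwd at hl
    cases a <;> cases b
    · simp only [base]
      cases l with
      | nil => simp
      | cons d l =>
        have hd := hl d (by simp)
        have hle : ∀ x ∈ d :: l, x.1 ≤ d.1 ∧ x.2 ≤ d.2 := by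
          intro x hx
          rcases List.mem_cons.mp hx with rfl | hx
          · exact ⟨le_rfl, le_rfl⟩
          · have := (List.pairwise_cons.mp h1.2).1 x hx
            exact ⟨this.2.1, this.2.2.1⟩
        by_cases hd1 : d.1 < c.1
        · refine le_trans (hrect _ _ fun x hx => ?_) (le_max_left _ _)
          have := hle x hx
          omega
        · refine le_trans (hrect _ _ fun x hx => ?_) (le_max_right _ _)
          have := hle x hx
          have : d.2 ≠ c.2 := fun h => hd.1 (Prod.ext (by omega) h)
          omega
    · refine hrect _ _ fun x hx => ?_
      have := hl x hx
      simp only [forall_const] at this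
      omega
    · refine hrect _ _ fun x hx => ?_
      have := hl x hx
      simp only [forall_const] at this
      omega
    · refine hrect _ _ fun x hx => ?_
      have := hl x hx
      simp only [forall_const] at this
      omega

theorem exists_chainValue_eq_growth (i : ℕ) :
    ∀ j, ∃ l, IsRectChain (fun p q => IsFwd a b q p) m i j l ∧
      chainValue a b m l = growth R.out m i j := by
  have hnil : ∀ i j, IsRectChain (fun p q => IsFwd a b q p) m i j [] := fun i j => by
    simp [IsRectChain]
  have hmono : ∀ {i j i' j' l}, IsRectChain (fun p q => IsFwd a b q p) m i j l → i ≤ i' → j ≤ j' →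
      IsRectChain (fun p q => IsFwd a b q p) m i' j' l := fun h hi hj =>
    ⟨h.1, fun c hc => ⟨(h.2 c hc).1.trans_le hi, (h.2 c hc).2.1.trans_le hj, (h.2 c hc).2.2⟩⟩
  induction i with
  | zero => exact fun j => ⟨[], hnil _ _, by simp⟩
  | succ i ihi =>
    intro j
    induction j with
    | zero => exact ⟨[], hnil _ _, by simp⟩
    | succ j ihj =>
      obtain ⟨lm, hlm, hvm⟩ := ihi (j + 1)
      obtain ⟨lr, hlr, hvr⟩ := ihi j
      obtain ⟨ln, hln, hvn⟩ := ihj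
      have hG := R.growth_succ_succ_eq hm i j
      by_cases h1 : growth R.out m (i + 1) (j + 1) = growth R.out m i (j + 1)
      · exact ⟨lm, hmono hlm (by omega) le_rfl, by rw [hvm, h1]⟩
      by_cases h2 : growth R.out m (i + 1) (j + 1) = growth R.out m (i + 1) j
      · exact ⟨ln, hmono hln le_rfl (by omega), by rw [hvn, h2]⟩
      have h3 : growth R.out m (i + 1) (j + 1) = base a b (growth R.out m i j)
          (growth R.out m i (j + 1)) (growth R.out m (i + 1) j) + weight a b (m i j) := by
        rcases max_choice (max (growth R.out m i (j + 1)) (growth R.out m (i + 1) j))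
          (base a b (growth R.out m i j) (growth R.out m i (j + 1)) (growth R.out m (i + 1) j) +
            weight a b (m i j)) with h | h
        · rcases max_choice (growth R.out m i (j + 1)) (growth R.out m (i + 1) j) with h' | h' <;>
            omega
        · omega
      have hne : m i j ≠ 0 := by
        -- With a zero entry the third term would not exceed the two neighbours, a case already
        -- excluded.
        intro h0
        rw [weight_eq_zero.mpr h0] at h3
        have hs := R.growth_stepBound hm i j
        have hs1 := (R.growth_stepBound hm i (j + 1)).1.1
        have hs2 := (R.growth_stepBound hm (i + 1) j).2.1
        have := hs.1.1
        have := hs.2.1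
        cases a <;> cases b <;> simp only [base] at h3 <;> omega
      have hcell : ∀ l i' j', IsRectChain (fun p q => IsFwd a b q p) m i' j' l →
          chainValue a b m l = base a b (growth R.out m i j)
            (growth R.out m i (j + 1)) (growth R.out m (i + 1) j) →
          (∀ x : ℕ × ℕ, x.1 < i' → x.2 < j' → IsFwd a b x (i, j)) →
          ∃ l, IsRectChain (fun p q => IsFwd a b q p) m (i + 1) (j + 1) l ∧
            chainValue a b m l = growth R.out m (i + 1) (j + 1) := by
        intro l i' j' hl hv hx
        refine ⟨(i, j) :: l, ⟨List.pairwise_cons.mpr ⟨fun x hxl =>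
          hx x (hl.2 x hxl).1 (hl.2 x hxl).2.1, hl.1⟩, ?_⟩, ?_⟩
        · intro c hc
          rcases List.mem_cons.mp hc with rfl | hc
          · exact ⟨i.lt_succ_self, j.lt_succ_self, hne⟩
          · obtain ⟨-, h4, h5, -⟩ := hx c (hl.2 c hc).1 (hl.2 c hc).2.1
            exact ⟨Nat.lt_succ_of_le h4, Nat.lt_succ_of_le h5, (hl.2 c hc).2.2⟩
        · rw [chainValue_cons, hv, h3, add_comm]
      have hfwd : ∀ x : ℕ × ℕ, x.1 ≤ i → x.2 ≤ j → (x.1 < i ∨ x.2 < j) → (a = true → x.1 < i) →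
          (b = true → x.2 < j) → IsFwd a b x (i, j) := by
        intro x h4 h5 h6 h7 h8
        refine ⟨fun h => ?_, h4, h5, fun ha => (h7 ha).ne, fun hb => (h8 hb).ne⟩
        rw [h] at h6
        simp only at h6
        omega
      cases a <;> cases b
      · rcases max_choice (growth R.out m i (j + 1)) (growth R.out m (i + 1) j) with h | h
        · exact hcell lm _ _ hlm (by rw [hvm]; simp only [base, h])
            fun x h4 h5 => hfwd x (by omega) (by omega) (by omega) (by simp) (by simp)
        · exact hcell ln _ _ hln (by rw [hvn]; simp only [base, h])
            fun x h4 h5 => hfwd x (by omega) (by omega) (by omega) (by simp) (by simp)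
      · exact hcell ln _ _ hln (by rw [hvn]; simp only [base])
            fun x h4 h5 => hfwd x (by omega) (by omega) (by omega) (by simp) (by simp [h5])
      · exact hcell lm _ _ hlm (by rw [hvm]; simp only [base])
            fun x h4 h5 => hfwd x (by omega) (by omega) (by omega) (by simp [h4]) (by simp)
      · exact hcell lr _ _ hlr (by rw [hvr]; simp only [base])
            fun x h4 h5 => hfwd x (by omega) (by omega) (by omega) (by simp [h4]) (by simp [h5])

/-- The first row length is the length of the longest chain. -/
theorem isGreatest_growth (I J : ℕ) :
    IsGreatest (chainLengths (IsFwd a b) a b m I J) (growth R.out m I J) := by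
  constructor
  · obtain ⟨l, ⟨h1, h2⟩, h3⟩ := R.exists_chainValue_eq_growth hm I J
    exact ⟨l.reverse, ⟨List.pairwise_reverse.mpr h1, fun c hc => h2 c (List.mem_reverse.mp hc)⟩,
      by rw [chainValue_reverse, h3]⟩
  · rintro d ⟨l, ⟨h1, h2⟩, rfl⟩
    rw [← chainValue_reverse]
    exact R.chainValue_le_growth hm _ I J
      ⟨List.pairwise_reverse.mpr h1, fun c hc => h2 c (List.mem_reverse.mp hc)⟩

theorem eq_zero_of_growth_eq_zero {I J i j : ℕ} (h : growth R.out m I J = 0) (hi : i < I)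
    (hj : j < J) : m i j = 0 := by
  by_contra hne
  have := R.chainValue_le_growth hm [(i, j)] I J (by simp [IsRectChain, hi, hj, hne])
  rw [h, chainValue_cons, chainValue_nil] at this
  exact hne ((weight_eq_zero (a := a) (b := b)).mp (Nat.le_zero.mp this))

end

/-- If taking the derived filling shortens the longest dual chain by one, then the number of rows
is the length of the longest dual chain. -/
theorem isGreatest_conj_shape
    (hup : ∀ m : ℕ → ℕ → ℕ, (∀ i j, Allowed a b (m i j)) → ∀ I J l, l ≠ [] →
      IsRectChain (IsBwd (!a) (!b)) (derived R.out m) I J l →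
      ∃ l', IsRectChain (IsBwd (!a) (!b)) m I J l' ∧
        chainValue (!a) (!b) (derived R.out m) l + 1 ≤ chainValue (!a) (!b) m l')
    (hdown : ∀ m : ℕ → ℕ → ℕ, (∀ i j, Allowed a b (m i j)) → ∀ I J l, l ≠ [] →
      IsRectChain (IsBwd (!a) (!b)) m I J l →
      ∃ l', IsRectChain (IsBwd (!a) (!b)) (derived R.out m) I J l' ∧
        chainValue (!a) (!b) m l ≤ chainValue (!a) (!b) (derived R.out m) l' + 1)
    {m : ℕ → ℕ → ℕ} (hm : ∀ i j, Allowed a b (m i j)) (I J : ℕ) :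
    IsGreatest (chainLengths (IsBwd (!a) (!b)) (!a) (!b) m I J) (conj (shape R.out m I J) 0) := by
  have hpart : ∀ {m : ℕ → ℕ → ℕ}, (∀ i j, Allowed a b (m i j)) →
      IsPartition (shape R.out m I J) := fun hm => (R.shape_valid hm I J).1
  suffices H : ∀ d (m : ℕ → ℕ → ℕ), (∀ i j, Allowed a b (m i j)) →
      conj (shape R.out m I J) 0 = d →
      (∃ l, IsRectChain (IsBwd (!a) (!b)) m I J l ∧ d ≤ chainValue (!a) (!b) m l) ∧
      ∀ l, IsRectChain (IsBwd (!a) (!b)) m I J l → chainValue (!a) (!b) m l ≤ d by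
    obtain ⟨⟨l, hl, hle⟩, hub⟩ := H _ m hm rfl
    refine ⟨⟨l, hl, le_antisymm (hub l hl) hle⟩, ?_⟩
    rintro d ⟨l, hl, rfl⟩
    exact hub l hl
  intro d
  induction d with
  | zero =>
    intro m hm hd
    refine ⟨⟨[], by simp [IsRectChain], by simp⟩, fun l hl => ?_⟩
    cases l with
    | nil => simp
    | cons c l =>
      exfalso
      obtain ⟨h1, h2, h3⟩ := hl.2 c (by simp)
      refine h3 (R.eq_zero_of_growth_eq_zero hm ?_ h1 h2)
      by_contra hg
      have := ((hpart hm).lt_conj (i := 0) (k := 0)).mpr (Nat.pos_of_ne_zero hg)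
      omega
  | succ d ih =>
    intro m hm hd
    -- Passing to the derived filling deletes the first row of the partition.
    have hd' : conj (shape R.out (derived R.out m) I J) 0 = d := by
      refine eq_of_forall_lt_iff fun i => ?_
      rw [(hpart (R.allowed_derived hm)).lt_conj, ← shape_succ, ← (hpart hm).lt_conj, hd]
      omega
    obtain ⟨⟨l, hl, hle⟩, hub⟩ := ih _ (R.allowed_derived hm) hd'
    constructor
    -- `hup` needs a non-empty chain. If there is none, the partition has one row and any non-zero
    -- entry serves as a chain.
    · by_cases hnil : l = []
      · subst hnil
        have hd0 : d = 0 := by simpa using hle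
        have hg : 0 < growth R.out m I J := ((hpart hm).lt_conj (i := 0) (k := 0)).mp (by omega)
        obtain ⟨c, h1, h2⟩ := R.exists_chainValue_eq_growth hm I J
        cases c with
        | nil =>
          simp only [chainValue_nil] at h2
          omega
        | cons c _ =>
          obtain ⟨h3, h4, h5⟩ := h1.2 c (by simp)
          refine ⟨[c], by simp [IsRectChain, h3, h4, h5], ?_⟩
          have := (weight_eq_zero (a := !a) (b := !b)).not.mpr h5
          rw [chainValue_cons, chainValue_nil]
          omega
      · obtain ⟨l', hl', hle'⟩ := hup m hm I J l hnil hl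
        exact ⟨l', hl', by omega⟩
    · intro l hl
      by_cases hnil : l = []
      · simp [hnil]
      · obtain ⟨l', hl', hle'⟩ := hdown m hm I J l hnil hl
        have := hub l' hl'
        omega

end GrowthRule

/-! ### Dual chains that are strict in some direction -/

theorem chainValue_eq_length {a b : Bool} (hab : a = true ∨ b = true) {m : ℕ → ℕ → ℕ}
    {l : List (ℕ × ℕ)} (hl : ∀ c ∈ l, m c.1 c.2 ≠ 0) : chainValue a b m l = l.length := by
  induction l with
  | nil => rfl
  | cons c l ih =>
    have hc : weight a b (m c.1 c.2) = 1 := by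
      have := hl c (by simp)
      rw [weight, if_neg (by rcases hab with h | h <;> simp [h])]
      omega
    rw [chainValue_cons, ih fun x hx => hl x (List.mem_cons_of_mem _ hx), hc, List.length_cons,
      add_comm]

/-- Interlacing a chain: if between any two successive elements of a chain of `P`-cells there is a
`Q`-cell, then these `Q`-cells form a chain. -/
theorem exists_interlaced {α : Type*} {Rel Bel : α → α → Prop} {T : α → α → α → Prop}
    {P Q : α → Prop} {e : ℕ}
    (hbetween : ∀ q q', Rel q q' → P q → P q' → ∃ u, Q u ∧ T q q' u)
    (hT : ∀ q q' u, T q q' u → Bel q u)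
    (hrel : ∀ q q' u x, T q q' u → Bel q' x → Rel u x)
    (hbel : ∀ q q' x, Rel q q' → Bel q' x → Bel q x)
    (hend : ∀ q, P q → ∃ l : List α, l.length = e ∧ l.Pairwise Rel ∧ ∀ x ∈ l, Q x ∧ Bel q x)
    (l : List α) : ∀ q, (q :: l).Pairwise Rel → (∀ x ∈ q :: l, P x) →
      ∃ l' : List α, l'.length = l.length + e ∧ l'.Pairwise Rel ∧ ∀ x ∈ l', Q x ∧ Bel q x := by
  induction l with
  | nil =>
    intro q _ hP
    simpa using hend q (hP q (by simp))
  | cons q' l ih =>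
    intro q h hP
    rw [List.pairwise_cons] at h
    have hqq := h.1 q' (by simp)
    obtain ⟨l', h1, h2, h3⟩ := ih q' h.2 fun x hx => hP x (List.mem_cons_of_mem _ hx)
    obtain ⟨u, hu, hTu⟩ := hbetween q q' hqq (hP q (by simp)) (hP q' (by simp))
    refine ⟨u :: l', by simp only [List.length_cons, h1]; omega,
      List.pairwise_cons.mpr ⟨fun x hx => hrel q q' u x hTu (h3 x hx).2, h2⟩, fun x hx => ?_⟩
    rcases List.mem_cons.mp hx with rfl | hx
    · exact ⟨hu, hT _ _ _ hTu⟩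
    · exact ⟨(h3 x hx).1, hbel q q' x hqq (h3 x hx).2⟩

theorem exists_jump {f : ℕ → ℕ} (hf : Monotone f) {p q : ℕ} (hpq : p ≤ q) (h : f p < f q) :
    ∃ k, p ≤ k ∧ k < q ∧ f k = f p ∧ f p < f (k + 1) := by
  induction q, hpq using Nat.le_induction with
  | base => omega
  | succ q hq ih =>
    by_cases hlt : f p < f q
    · obtain ⟨k, h1, h2, h3⟩ := ih hlt
      exact ⟨k, h1, by omega, h3⟩
    · exact ⟨q, hq, by omega, le_antisymm (not_lt.mp hlt) (hf hq), h⟩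

/-! ### Jumps of the growth along stretches of zero entries -/

namespace GrowthRule

section

variable {a b : Bool} (R : GrowthRule a b)
variable {m : ℕ → ℕ → ℕ} (hm : ∀ i j, Allowed a b (m i j))
include hm

theorem growth_of_eq_zero {i j : ℕ} (h : m i j = 0) : growth R.out m (i + 1) (j + 1) =
    max (growth R.out m i (j + 1)) (growth R.out m (i + 1) j) := by
  have hs := R.growth_stepBound hm i j
  have := hs.1.1
  have := hs.2.1
  rw [R.growth_succ_succ_eq hm, weight_eq_zero.mpr h]
  cases a <;> cases b <;> simp only [base] <;> omega

/-- Above a zero entry the value is the maximum of the two neighbours. As the left one is strictly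
smaller, the value comes from below. -/
theorem growth_column_const {i i' j : ℕ} (hi : i' ≤ i) (h : ∀ k, i' ≤ k → k < i → m k j = 0)
    (hlt : growth R.out m i j < growth R.out m i (j + 1)) :
    growth R.out m i' (j + 1) = growth R.out m i (j + 1) := by
  induction i, hi using Nat.le_induction with
  | base => rfl
  | succ i hi ih =>
    have h1 := R.growth_of_eq_zero hm (h i hi i.lt_succ_self)
    have h2 := (R.growth_stepBound hm i j).1.1
    rw [ih (fun k hk hk' => h k hk (by omega)) (by omega)]
    omega

theorem growth_row_const {i j j' : ℕ} (hj : j ≤ j') (h : ∀ k, j ≤ k → k < j' → m i k = 0)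
    (hlt : growth R.out m i j' < growth R.out m (i + 1) j') :
    growth R.out m (i + 1) j = growth R.out m (i + 1) j' := by
  induction j', hj using Nat.le_induction with
  | base => rfl
  | succ j' hj ih =>
    have h1 := R.growth_of_eq_zero hm (h j' hj j'.lt_succ_self)
    have h2 := (R.growth_stepBound hm i j').2.1
    rw [ih (fun k hk hk' => h k hk (by omega)) (by omega)]
    omega

theorem exists_left_of_lt {i j : ℕ} (h : growth R.out m i j < growth R.out m (i + 1) j) :
    ∃ k < j, m i k ≠ 0 := by
  by_contra! hno
  have := R.growth_row_const hm (Nat.zero_le j) (fun k _ hk => hno k hk) h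
  rw [growth_zero_right] at this
  omega

theorem exists_below_of_lt {i j : ℕ} (h : growth R.out m i j < growth R.out m i (j + 1)) :
    ∃ k < i, m k j ≠ 0 := by
  by_contra! hno
  have := R.growth_column_const hm (Nat.zero_le i) (fun k _ hk => hno k hk) h
  rw [growth_zero_left] at this
  omega

/-- If both legs of the hook through `(i', j)` were zero, constancy along them and monotonicity
would give the cycle `g(i', j') ≥ g(i, j + 1) > g(i, j) ≥ g(i' + 1, j') > g(i', j')`. -/
theorem exists_between_of_lt {i j i' j' : ℕ} (hi : i' < i) (hj : j < j')
    (h : growth R.out m i j < growth R.out m i (j + 1))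
    (h' : growth R.out m i' j' < growth R.out m (i' + 1) j') :
    (∃ k, i' ≤ k ∧ k < i ∧ m k j ≠ 0) ∨ ∃ k, j ≤ k ∧ k < j' ∧ m i' k ≠ 0 := by
  by_contra! hno
  have h1 := R.growth_column_const hm hi.le hno.1 h
  have h2 := R.growth_row_const hm hj.le hno.2 h'
  have h3 := R.growth_mono hm (show i' + 1 ≤ i from hi) (le_refl j)
  have h4 := R.growth_mono hm (le_refl i') (show j + 1 ≤ j' from hj)
  omega

end

/-! #### Chains that are weak in both directions -/

section NE

variable {m : ℕ → ℕ → ℕ}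

theorem allowed_ruleNE (m : ℕ → ℕ → ℕ) (i j : ℕ) : Allowed false false (m i j) := by simp [Allowed]

theorem growth_ruleNE (i j : ℕ) : growth ruleNE.out m (i + 1) (j + 1) =
    max (growth ruleNE.out m i (j + 1)) (growth ruleNE.out m (i + 1) j) + m i j :=
  growth_succ_succ i j

theorem derived_ruleNE_ne_zero {i j : ℕ} : derived ruleNE.out m i j ≠ 0 ↔
    growth ruleNE.out m i j < growth ruleNE.out m i (j + 1) ∧
    growth ruleNE.out m i j < growth ruleNE.out m (i + 1) j := by
  have h1 := ruleNE.derived_add (allowed_ruleNE m) i j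
  have h2 := growth_ruleNE (m := m) i j
  have h3 := ruleNE.growth_stepBound (allowed_ruleNE m) i j
  have := h3.1.1
  have := h3.2.1
  omega

/-- A derived entry is non-zero where the growth jumps in both directions. First a horizontal jump
is located at height `i' + 1`, then a vertical one on the left side of that column; monotonicity
preserves the horizontal jump there. -/
theorem exists_derived_ruleNE {i j i' j' : ℕ} (hi : i' < i) (hj : j < j') (h : m i j ≠ 0)
    (h' : m i' j' ≠ 0) : ∃ k l, i' < k ∧ k ≤ i ∧ j < l ∧ l ≤ j' ∧ derived ruleNE.out m k l ≠ 0 := by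
  have hmono := fun {i j i' j' : ℕ} => ruleNE.growth_mono (allowed_ruleNE m)
    (i := i) (j := j) (i' := i') (j' := j')
  have h1 := growth_ruleNE (m := m) i j
  have h2 := growth_ruleNE (m := m) i' j'
  have h3 := hmono (show i' + 1 ≤ i from hi) (le_refl (j + 1))
  have h4 := hmono (le_refl (i' + 1)) (show j + 1 ≤ j' from hj)
  obtain ⟨l, hl1, hl2, hl3, hl4⟩ := exists_jump (f := fun l => growth ruleNE.out m (i' + 1) l)
    (fun _ _ h => hmono le_rfl h) (show j + 1 ≤ j' + 1 by omega) (by omega)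
  have h5 := hmono (le_refl (i + 1)) hl1
  obtain ⟨k, hk1, hk2, hk3, hk4⟩ := exists_jump (f := fun k => growth ruleNE.out m k l)
    (fun _ _ h => hmono h le_rfl) (show i' + 1 ≤ i + 1 by omega) (by omega)
  have h6 := hmono hk1 (le_refl (l + 1))
  exact ⟨k, l, by omega, by omega, by omega, by omega,
    derived_ruleNE_ne_zero.mpr ⟨by omega, by omega⟩⟩

theorem isGreatest_conj_ruleNE (m : ℕ → ℕ → ℕ) (I J : ℕ) :
    IsGreatest (chainLengths (IsBwd true true) true true m I J)
      (conj (shape ruleNE.out m I J) 0) := by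
  refine ruleNE.isGreatest_conj_shape ?_ ?_ (allowed_ruleNE m) I J
  · rintro m hm I J (_ | ⟨q, l⟩) hnil ⟨h1, h2⟩
    · exact absurd rfl hnil
    -- One cell between successive cells and one below the last (`e = 1`); a cell to the left of the
    -- first is added afterwards, for a net gain of one.
    obtain ⟨l', hl1, hl2, hl3⟩ := exists_interlaced (Rel := IsBwd true true)
      (P := fun c => c.1 < I ∧ c.2 < J ∧ derived ruleNE.out m c.1 c.2 ≠ 0)
      (Q := fun c => c.1 < I ∧ c.2 < J ∧ m c.1 c.2 ≠ 0)
      (Bel := fun q x => x.1 < q.1 ∧ q.2 ≤ x.2)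
      (T := fun q q' u => q'.1 ≤ u.1 ∧ u.1 < q.1 ∧ q.2 ≤ u.2 ∧ u.2 < q'.2) (e := 1)
      (by
        rintro ⟨i, j⟩ ⟨i', j'⟩ hR ⟨h3, h4, h5⟩ ⟨h6, h7, h8⟩
        simp only [IsBwd, forall_const] at hR h3 h4 h5 h6 h7 h8 ⊢
        rcases ruleNE.exists_between_of_lt hm (i := i) (j := j) (i' := i') (j' := j') (by omega)
          (by omega) (derived_ruleNE_ne_zero.mp h5).1 (derived_ruleNE_ne_zero.mp h8).2 with
          ⟨k, hk1, hk2, hk3⟩ | ⟨k, hk1, hk2, hk3⟩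
        · exact ⟨(k, j), ⟨by omega, h4, hk3⟩, by omega⟩
        · exact ⟨(i', k), ⟨h6, by omega, hk3⟩, by omega⟩)
      (fun q q' u hT => ⟨hT.2.1, hT.2.2.1⟩)
      (fun q q' u x hT hB => by
        simp only [IsBwd, forall_const, ne_eq, Prod.ext_iff] at hT hB ⊢; omega)
      (fun q q' x hR hB => by
        simp only [IsBwd, forall_const, ne_eq, Prod.ext_iff] at hR hB ⊢; omega)
      (by
        rintro ⟨i, j⟩ ⟨h3, h4, h5⟩
        obtain ⟨k, hk1, hk2⟩ := ruleNE.exists_below_of_lt hm (derived_ruleNE_ne_zero.mp h5).1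
        simp only at h3 h4 hk1 hk2
        refine ⟨[(k, j)], rfl, by simp, ?_⟩
        simp only [List.mem_singleton, forall_eq]
        exact ⟨⟨by omega, h4, hk2⟩, hk1, le_rfl⟩) l q h1 h2
    obtain ⟨hq1, hq2, hq3⟩ := h2 q (by simp)
    obtain ⟨k, hk1, hk2⟩ := ruleNE.exists_left_of_lt hm (derived_ruleNE_ne_zero.mp hq3).2
    have hQ : ∀ c ∈ (q.1, k) :: l', c.1 < I ∧ c.2 < J ∧ m c.1 c.2 ≠ 0 := by
      intro c hc
      rcases List.mem_cons.mp hc with rfl | hc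
      · exact ⟨hq1, by simp only; omega, hk2⟩
      · exact (hl3 c hc).1
    refine ⟨(q.1, k) :: l', ⟨List.pairwise_cons.mpr ⟨fun x hx => ?_, hl2⟩, hQ⟩, ?_⟩
    · have := (hl3 x hx).2
      simp only [Bool.not_false, IsBwd, forall_const, ne_eq, Prod.ext_iff]
      omega
    · rw [chainValue_eq_length (by simp) fun c hc => (h2 c hc).2.2,
        chainValue_eq_length (by simp) fun c hc => (hQ c hc).2.2]
      simp only [List.length_cons]
      omega
  · rintro m hm I J (_ | ⟨q, l⟩) hnil ⟨h1, h2⟩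
    · exact absurd rfl hnil
    -- Only the cells between successive ones (`e = 0`), so exactly one is lost.
    obtain ⟨l', hl1, hl2, hl3⟩ := exists_interlaced (Rel := IsBwd true true)
      (P := fun c => c.1 < I ∧ c.2 < J ∧ m c.1 c.2 ≠ 0)
      (Q := fun c => c.1 < I ∧ c.2 < J ∧ derived ruleNE.out m c.1 c.2 ≠ 0)
      (Bel := fun q x => x.1 ≤ q.1 ∧ q.2 < x.2)
      (T := fun q q' u => q'.1 < u.1 ∧ u.1 ≤ q.1 ∧ q.2 < u.2 ∧ u.2 ≤ q'.2) (e := 0)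
      (by
        rintro ⟨i, j⟩ ⟨i', j'⟩ hR ⟨h3, h4, h5⟩ ⟨h6, h7, h8⟩
        simp only [IsBwd, forall_const] at hR h3 h4 h5 h6 h7 h8 ⊢
        obtain ⟨k, k', hk1, hk2, hk3, hk4, hk5⟩ := exists_derived_ruleNE (i := i) (j := j)
          (i' := i') (j' := j') (by omega) (by omega) h5 h8
        exact ⟨(k, k'), ⟨by omega, by omega, hk5⟩, by omega⟩)
      (fun q q' u hT => ⟨hT.2.1, hT.2.2.1⟩)
      (fun q q' u x hT hB => by
        simp only [IsBwd, forall_const, ne_eq, Prod.ext_iff] at hT hB ⊢; omega)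
      (fun q q' x hR hB => by
        simp only [IsBwd, forall_const, ne_eq, Prod.ext_iff] at hR hB ⊢; omega)
      (fun q _ => ⟨[], rfl, by simp, by simp⟩) l q h1 h2
    refine ⟨l', ⟨hl2, fun c hc => (hl3 c hc).1⟩, ?_⟩
    rw [chainValue_eq_length (by simp) fun c hc => (h2 c hc).2.2,
      chainValue_eq_length (by simp) fun c hc => (hl3 c hc).1.2.2]
    simp only [List.length_cons]
    omega

end NE

/-! #### Chains that are strict in the vertical direction -/

section nE

variable {m : ℕ → ℕ → ℕ} (hm : ∀ i j, Allowed true false (m i j))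

theorem growth_rulenE (i j : ℕ) : growth rulenE.out m (i + 1) (j + 1) =
    max (growth rulenE.out m (i + 1) j) (growth rulenE.out m i (j + 1) + m i j) :=
  growth_succ_succ i j

include hm

theorem derived_rulenE_ne_zero {i j : ℕ} : derived rulenE.out m i j ≠ 0 ↔
    growth rulenE.out m i j < growth rulenE.out m i (j + 1) + m i j ∧
    growth rulenE.out m i j < growth rulenE.out m (i + 1) j := by
  have h1 := rulenE.derived_add hm i j
  have h2 := growth_rulenE (m := m) i j
  have h3 := rulenE.growth_stepBound hm i j
  have := h3.1.1
  have := h3.2.1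
  omega

theorem exists_below_of_derived_rulenE {i j : ℕ} (h : derived rulenE.out m i j ≠ 0) :
    ∃ k ≤ i, m k j ≠ 0 := by
  by_cases h0 : m i j = 0
  · obtain ⟨k, hk1, hk2⟩ := rulenE.exists_below_of_lt hm (i := i) (j := j)
      (by have := ((derived_rulenE_ne_zero hm).mp h).1; omega)
    exact ⟨k, hk1.le, hk2⟩
  · exact ⟨i, le_rfl, h0⟩

theorem exists_between_derived_rulenE {i j i' j' : ℕ} (hi : i' ≤ i) (hj : j < j')
    (h : derived rulenE.out m i j ≠ 0) (h' : derived rulenE.out m i' j' ≠ 0) :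
    ∃ k l, i' ≤ k ∧ k ≤ i ∧ j ≤ l ∧ l < j' ∧ m k l ≠ 0 := by
  by_cases h0 : m i j = 0
  · obtain ⟨h1, h2⟩ := (derived_rulenE_ne_zero hm).mp h
    obtain ⟨-, h4⟩ := (derived_rulenE_ne_zero hm).mp h'
    rcases hi.lt_or_eq with hlt | rfl
    · rcases rulenE.exists_between_of_lt hm hlt hj (by omega) h4 with
        ⟨k, hk1, hk2, hk3⟩ | ⟨k, hk1, hk2, hk3⟩
      · exact ⟨k, j, hk1, hk2.le, le_rfl, hj, hk3⟩
      · exact ⟨i', k, le_rfl, hi, hk1, hk2, hk3⟩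
    · by_contra! hno
      have h5 := rulenE.growth_row_const hm hj.le (fun k hk hk' => hno i' k le_rfl le_rfl hk hk') h4
      have h6 := rulenE.growth_mono hm (le_refl i') (show j + 1 ≤ j' from hj)
      have h7 := (rulenE.growth_stepBound hm i' j).1.2 rfl
      omega
  · exact ⟨i, j, hi, le_rfl, le_rfl, hj, h0⟩

theorem exists_derived_rulenE {i j i' j' : ℕ} (hi : i' ≤ i) (hj : j < j') (h : m i j ≠ 0)
    (h' : m i' j' ≠ 0) : ∃ k l, i' ≤ k ∧ k ≤ i ∧ j < l ∧ l ≤ j' ∧ derived rulenE.out m k l ≠ 0 := by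
  have hmono := fun {i j i' j' : ℕ} => rulenE.growth_mono hm
    (i := i) (j := j) (i' := i') (j' := j')
  have h1 := growth_rulenE (m := m) i j
  have h2 := growth_rulenE (m := m) i' j'
  have h3 := hmono hi (le_refl (j + 1))
  have h4 := hmono (le_refl i') (show j + 1 ≤ j' from hj)
  by_cases hc : growth rulenE.out m i' (j + 1) < growth rulenE.out m i' (j' + 1)
  · obtain ⟨l, hl1, hl2, hl3, hl4⟩ := exists_jump (f := fun l => growth rulenE.out m i' l)
      (fun _ _ h => hmono le_rfl h) (show j + 1 ≤ j' + 1 by omega) hc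
    have h5 := hmono (le_refl (i + 1)) hl1
    obtain ⟨k, hk1, hk2, hk3, hk4⟩ := exists_jump (f := fun k => growth rulenE.out m k l)
      (fun _ _ h => hmono h le_rfl) (show i' ≤ i + 1 by omega) (by omega)
    have h6 := hmono hk1 (le_refl (l + 1))
    exact ⟨k, l, hk1, by omega, by omega, by omega,
      (derived_rulenE_ne_zero hm).mpr ⟨by omega, by omega⟩⟩
  -- There is no horizontal jump at height `i'`. The non-zero entry at `(i', j')` makes up for it:
  -- either that cell is derived non-zero, or it lifts the growth on its upper right and a vertical
  -- jump further up on the line `j'` works.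
  · have h7 := hmono (le_refl i') (show j' ≤ j' + 1 by omega)
    by_cases hc' : growth rulenE.out m i' j' < growth rulenE.out m (i' + 1) j'
    · exact ⟨i', j', le_rfl, hi, hj, le_rfl, (derived_rulenE_ne_zero hm).mpr ⟨by omega, hc'⟩⟩
    · have h8 := hmono (le_refl (i + 1)) (show j + 1 ≤ j' from hj)
      have h9 : i' + 1 ≤ i := by
        by_contra hlt
        obtain rfl : i = i' := by omega
        omega
      obtain ⟨k, hk1, hk2, hk3, hk4⟩ := exists_jump (f := fun k => growth rulenE.out m k j')
        (fun _ _ h => hmono h le_rfl) (show i' + 1 ≤ i + 1 by omega) (by omega)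
      have h10 := hmono hk1 (le_refl (j' + 1))
      exact ⟨k, j', by omega, by omega, hj, le_rfl,
        (derived_rulenE_ne_zero hm).mpr ⟨by omega, by omega⟩⟩

theorem isGreatest_conj_rulenE (I J : ℕ) :
    IsGreatest (chainLengths (IsBwd false true) false true m I J)
      (conj (shape rulenE.out m I J) 0) := by
  refine rulenE.isGreatest_conj_shape ?_ ?_ hm I J
  · rintro m hm I J (_ | ⟨q, l⟩) hnil ⟨h1, h2⟩
    · exact absurd rfl hnil
    obtain ⟨l', hl1, hl2, hl3⟩ := exists_interlaced (Rel := IsBwd false true)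
      (P := fun c => c.1 < I ∧ c.2 < J ∧ derived rulenE.out m c.1 c.2 ≠ 0)
      (Q := fun c => c.1 < I ∧ c.2 < J ∧ m c.1 c.2 ≠ 0)
      (Bel := fun q x => x.1 ≤ q.1 ∧ q.2 ≤ x.2)
      (T := fun q q' u => q'.1 ≤ u.1 ∧ u.1 ≤ q.1 ∧ q.2 ≤ u.2 ∧ u.2 < q'.2) (e := 1)
      (by
        rintro ⟨i, j⟩ ⟨i', j'⟩ hR ⟨h3, h4, h5⟩ ⟨h6, h7, h8⟩
        simp only [IsBwd, forall_const] at hR h3 h4 h5 h6 h7 h8 ⊢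
        obtain ⟨k, k', hk1, hk2, hk3, hk4, hk5⟩ := exists_between_derived_rulenE hm (i := i)
          (j := j) (i' := i') (j' := j') (by omega) (by omega) h5 h8
        exact ⟨(k, k'), ⟨by omega, by omega, hk5⟩, by omega⟩)
      (fun q q' u hT => ⟨hT.2.1, hT.2.2.1⟩)
      (fun q q' u x hT hB => by
        simp only [IsBwd, forall_const, ne_eq, Prod.ext_iff, Bool.false_eq_true, false_implies, true_and]
          at hT hB ⊢
        omega)
      (fun q q' x hR hB => by
        simp only [IsBwd, forall_const, ne_eq, Prod.ext_iff] at hR hB ⊢; omega)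
      (by
        rintro ⟨i, j⟩ ⟨h3, h4, h5⟩
        obtain ⟨k, hk1, hk2⟩ := exists_below_of_derived_rulenE hm h5
        simp only at h3 h4 hk1 hk2
        refine ⟨[(k, j)], rfl, by simp, ?_⟩
        simp only [List.mem_singleton, forall_eq]
        exact ⟨⟨by omega, h4, hk2⟩, hk1, le_rfl⟩) l q h1 h2
    obtain ⟨hq1, hq2, hq3⟩ := h2 q (by simp)
    obtain ⟨k, hk1, hk2⟩ := rulenE.exists_left_of_lt hm ((derived_rulenE_ne_zero hm).mp hq3).2
    have hQ : ∀ c ∈ (q.1, k) :: l', c.1 < I ∧ c.2 < J ∧ m c.1 c.2 ≠ 0 := by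
      intro c hc
      rcases List.mem_cons.mp hc with rfl | hc
      · exact ⟨hq1, by simp only; omega, hk2⟩
      · exact (hl3 c hc).1
    refine ⟨(q.1, k) :: l', ⟨List.pairwise_cons.mpr ⟨fun x hx => ?_, hl2⟩, hQ⟩, ?_⟩
    · have := (hl3 x hx).2
      simp only [Bool.not_false, Bool.not_true, IsBwd, forall_const, ne_eq, Prod.ext_iff,
        Bool.false_eq_true, false_implies, true_and]
      omega
    · rw [chainValue_eq_length (by simp) fun c hc => (h2 c hc).2.2,
        chainValue_eq_length (by simp) fun c hc => (hQ c hc).2.2]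
      simp only [List.length_cons]
      omega
  · rintro m hm I J (_ | ⟨q, l⟩) hnil ⟨h1, h2⟩
    · exact absurd rfl hnil
    obtain ⟨l', hl1, hl2, hl3⟩ := exists_interlaced (Rel := IsBwd false true)
      (P := fun c => c.1 < I ∧ c.2 < J ∧ m c.1 c.2 ≠ 0)
      (Q := fun c => c.1 < I ∧ c.2 < J ∧ derived rulenE.out m c.1 c.2 ≠ 0)
      (Bel := fun q x => x.1 ≤ q.1 ∧ q.2 < x.2)
      (T := fun q q' u => q'.1 ≤ u.1 ∧ u.1 ≤ q.1 ∧ q.2 < u.2 ∧ u.2 ≤ q'.2) (e := 0)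
      (by
        rintro ⟨i, j⟩ ⟨i', j'⟩ hR ⟨h3, h4, h5⟩ ⟨h6, h7, h8⟩
        simp only [IsBwd, forall_const] at hR h3 h4 h5 h6 h7 h8 ⊢
        obtain ⟨k, k', hk1, hk2, hk3, hk4, hk5⟩ := exists_derived_rulenE hm (i := i) (j := j)
          (i' := i') (j' := j') (by omega) (by omega) h5 h8
        exact ⟨(k, k'), ⟨by omega, by omega, hk5⟩, by omega⟩)
      (fun q q' u hT => ⟨hT.2.1, hT.2.2.1⟩)
      (fun q q' u x hT hB => by
        simp only [IsBwd, forall_const, ne_eq, Prod.ext_iff, Bool.false_eq_true, false_implies, true_and]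
          at hT hB ⊢
        omega)
      (fun q q' x hR hB => by
        simp only [IsBwd, forall_const, ne_eq, Prod.ext_iff] at hR hB ⊢; omega)
      (fun q _ => ⟨[], rfl, by simp, by simp⟩) l q h1 h2
    refine ⟨l', ⟨hl2, fun c hc => (hl3 c hc).1⟩, ?_⟩
    rw [chainValue_eq_length (by simp) fun c hc => (h2 c hc).2.2,
      chainValue_eq_length (by simp) fun c hc => (hl3 c hc).1.2.2]
    simp only [List.length_cons]
    omega

end nE

/-! #### Chains that are strict in the horizontal direction -/

section Ne

variable {m : ℕ → ℕ → ℕ}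

/-- The two mixed rules are transposes of each other, so the results for one carry over. -/
theorem growth_ruleNe (i : ℕ) : ∀ j, growth ruleNe.out m i j =
    growth rulenE.out (fun j i => m i j) j i := by
  induction i with
  | zero => simp
  | succ i ihi =>
    intro j
    induction j with
    | zero => simp
    | succ j ihj =>
      rw [growth_succ_succ, growth_succ_succ, ihi, ihi, ihj]
      rfl

theorem derived_ruleNe : derived ruleNe.out m =
    fun i j => derived rulenE.out (fun j i => m i j) j i := by
  funext i j
  rw [derived, derived, growth_ruleNe, growth_ruleNe, growth_ruleNe]
  change _ + _ + _ - (max _ _ + _) = _ + _ + _ - (max _ _ + _)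
  omega

theorem shape_ruleNe (i j : ℕ) : shape ruleNe.out m i j =
    shape rulenE.out (fun j i => m i j) j i := by
  funext k
  induction k generalizing m with
  | zero => exact growth_ruleNe i j
  | succ k ih => rw [shape_succ, shape_succ, ih, derived_ruleNe]

theorem isGreatest_conj_ruleNe (hm : ∀ i j, Allowed false true (m i j)) (I J : ℕ) :
    IsGreatest (chainLengths (IsBwd true false) true false m I J)
      (conj (shape ruleNe.out m I J) 0) := by
  have key := isGreatest_conj_rulenE (m := fun j i => m i j)
    (fun i j => by have := hm j i; simpa [Allowed] using this) J I
  rw [← shape_ruleNe] at key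
  have htr : ∀ (a b : Bool) (m : ℕ → ℕ → ℕ) (I J : ℕ),
      chainLengths (IsBwd a b) a b m I J ⊆ chainLengths (IsBwd b a) b a (fun j i => m i j) J I := by
    rintro a b m I J d ⟨l, ⟨h1, h2⟩, rfl⟩
    -- Transposition reverses the direction of south-east chains.
    refine ⟨(l.map Prod.swap).reverse, ⟨?_, ?_⟩, ?_⟩
    · rw [List.pairwise_reverse, List.pairwise_map]
      refine h1.imp fun {p q} h => ?_
      obtain ⟨h3, h4, h5, h6, h7⟩ := h
      exact ⟨fun h => h3 (Prod.swap_injective h).symm, h5, h4, fun h => (h7 h).symm,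
        fun h => (h6 h).symm⟩
    · simp only [List.mem_reverse, List.mem_map, forall_exists_index, and_imp]
      rintro _ x hx rfl
      have := h2 x hx
      exact ⟨this.2.1, this.1, this.2.2⟩
    · rw [chainValue_reverse, chainValue, chainValue, List.map_map]
      congr 1
      refine List.map_congr_left fun x _ => ?_
      simp only [Function.comp, Prod.fst_swap, Prod.snd_swap, weight, and_comm]
  have heq := (htr false true (fun j i => m i j) J I).antisymm (htr true false m I J)
  rw [heq] at key
  exact key

end Ne

end GrowthRule

/-! ### Dual chains that are weak in both directions -/

/-- There is a chain with sum at least `w` in the part of the rectangle `[0, I) × [0, J)` that is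
weakly to the south-east of `(i, j)`. -/
def HasChainFrom (m : ℕ → ℕ → ℕ) (I J i j w : ℕ) : Prop :=
  ∃ l, IsRectChain (IsBwd false false) m I J l ∧ (∀ x ∈ l, x.1 ≤ i ∧ j ≤ x.2) ∧
    w ≤ chainValue false false m l

namespace HasChainFrom

variable {m : ℕ → ℕ → ℕ} {I J i j w : ℕ}

theorem zero : HasChainFrom m I J i j 0 := ⟨[], by simp [IsRectChain], by simp, by simp⟩

/-- Zero entries are simply skipped, so whole lattice paths may be summed as if they were chains. -/
theorem extend {i' j' : ℕ} (h : HasChainFrom m I J i j w) (hi : i ≤ i') (hj : j' ≤ j)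
    (hne : i < i' ∨ j' < j) (hI : i' < I) (hJ : j' < J) :
    HasChainFrom m I J i' j' (w + m i' j') := by
  obtain ⟨l, ⟨h1, h2⟩, h3, h4⟩ := h
  by_cases h0 : m i' j' = 0
  · refine ⟨l, ⟨h1, h2⟩, fun x hx => ?_, by omega⟩
    have := h3 x hx
    omega
  · refine ⟨(i', j') :: l, ⟨List.pairwise_cons.mpr ⟨fun x hx => ?_, h1⟩, ?_⟩, ?_, ?_⟩
    · have := h3 x hx
      refine ⟨fun he => ?_, by simp only; omega, by simp only; omega, by simp, by simp⟩
      rw [← he] at this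
      simp only at this
      omega
    · simp only [List.mem_cons, forall_eq_or_imp]
      exact ⟨⟨hI, hJ, h0⟩, h2⟩
    · simp only [List.mem_cons, forall_eq_or_imp]
      refine ⟨⟨le_rfl, le_rfl⟩, fun x hx => ?_⟩
      have := h3 x hx
      omega
    · rw [chainValue_cons]
      simp only [weight, and_self, if_true]
      omega

theorem extend_left {j' : ℕ} (h : HasChainFrom m I J i j w) (hI : i < I) (hJ : j ≤ J)
    (hj : j' ≤ j) : HasChainFrom m I J i j' (w + ∑ l ∈ Finset.Ico j' j, m i l) := by
  induction hd : j - j' generalizing j' with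
  | zero =>
    obtain rfl : j' = j := by omega
    simpa using h
  | succ d ih =>
    have := (ih (j' := j' + 1) (by omega) (by omega)).extend (le_refl i) (j'.le_succ)
      (Or.inr j'.lt_succ_self) hI (by omega)
    rw [Finset.sum_eq_sum_Ico_succ_bot (by omega), add_comm (m i j'), ← add_assoc]
    exact this

theorem extend_up {i' : ℕ} (h : HasChainFrom m I J i j w) (hI : i' < I) (hJ : j < J)
    (hi : i ≤ i') : HasChainFrom m I J i' j (w + ∑ k ∈ Finset.Ico i i', m (k + 1) j) := by
  induction i', hi using Nat.le_induction with
  | base => simpa using h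
  | succ k hk ih =>
    rw [Finset.sum_Ico_succ_top hk, ← add_assoc]
    exact (ih (by omega)).extend k.le_succ le_rfl (Or.inl k.lt_succ_self) hI hJ

end HasChainFrom

namespace GrowthRule

section telescope

variable {a b : Bool} (R : GrowthRule a b)
variable {m : ℕ → ℕ → ℕ} (hm : ∀ i j, Allowed a b (m i j))
include hm

/-- The balance equations of the cells telescope along a row. -/
theorem sum_row_derived {i j j' : ℕ} (hj : j ≤ j') :
    ∑ l ∈ Finset.Ico j j', derived R.out m i l + growth R.out m (i + 1) j' + growth R.out m i j =
      ∑ l ∈ Finset.Ico j j', m i l + growth R.out m i j' + growth R.out m (i + 1) j := by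
  induction j', hj using Nat.le_induction with
  | base => simp only [Finset.Ico_self, Finset.sum_empty]; omega
  | succ k hk ih =>
    rw [Finset.sum_Ico_succ_top hk, Finset.sum_Ico_succ_top hk]
    have := R.derived_add hm i k
    omega

theorem sum_column_derived {i i' j : ℕ} (hi : i ≤ i') :
    ∑ k ∈ Finset.Ico i i', derived R.out m (k + 1) j + growth R.out m (i' + 1) (j + 1) +
        growth R.out m (i + 1) j =
      ∑ k ∈ Finset.Ico i i', m (k + 1) j + growth R.out m (i + 1) (j + 1) +
        growth R.out m (i' + 1) j := by
  induction i', hi using Nat.le_induction with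
  | base => simp only [Finset.Ico_self, Finset.sum_empty]
  | succ k hk ih =>
    rw [Finset.sum_Ico_succ_top hk, Finset.sum_Ico_succ_top hk]
    have := R.derived_add hm (k + 1) j
    omega

end telescope

theorem le_sum_row (m : ℕ → ℕ → ℕ) (i : ℕ) {j j' : ℕ} (h : j < j') :
    m i j ≤ ∑ l ∈ Finset.Ico j j', m i l :=
  Finset.single_le_sum (f := fun l => m i l) (fun _ _ => Nat.zero_le _)
    (Finset.mem_Ico.mpr ⟨le_rfl, h⟩)

theorem le_sum_column (m : ℕ → ℕ → ℕ) (j : ℕ) {i i' : ℕ} (h : i < i') :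
    m i' j ≤ ∑ k ∈ Finset.Ico i i', m (k + 1) j := by
  obtain ⟨d, rfl⟩ : ∃ d, i' = d + 1 := ⟨i' - 1, by omega⟩
  exact Finset.single_le_sum (f := fun k => m (k + 1) j) (fun _ _ => Nat.zero_le _)
    (Finset.mem_Ico.mpr ⟨by omega, d.lt_succ_self⟩)

section ne

variable {m : ℕ → ℕ → ℕ}

theorem allowed_rulene (m : ℕ → ℕ → ℕ) (i j : ℕ) : Allowed true true (m i j) := by simp [Allowed]

theorem growth_rulene (i j : ℕ) : growth rulene.out m (i + 1) (j + 1) =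
    max (max (growth rulene.out m i (j + 1)) (growth rulene.out m (i + 1) j))
      (growth rulene.out m i j + min 1 (m i j)) :=
  growth_succ_succ i j

theorem growth_rulene_diag_le (i j : ℕ) :
    growth rulene.out m (i + 1) (j + 1) ≤ growth rulene.out m i j + 1 := by
  have h1 := growth_rulene (m := m) i j
  have h2 := rulene.growth_stepBound (allowed_rulene m) i j
  have := h2.1.2 rfl
  have := h2.2.2 rfl
  omega

theorem growth_rulene_diag {i j : ℕ} (h : m i j ≠ 0 ∨ derived rulene.out m i j ≠ 0) :
    growth rulene.out m (i + 1) (j + 1) = growth rulene.out m i j + 1 := by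
  have h0 := growth_rulene_diag_le (m := m) i j
  have h1 := growth_rulene (m := m) i j
  have h2 := rulene.growth_stepBound (allowed_rulene m) i j
  have h3 := rulene.derived_add (allowed_rulene m) i j
  have := h2.1.1
  have := h2.2.1
  omega

/-- Successive cells are joined by a lattice path: up column `j'` to row `i`, then left to column
`j`. Telescoping compares the two fillings on it, and the difference `g(i + 1, j) - g(i, j)` is kept
as a potential so that the errors cancel along the chain and only `1` is lost. -/
theorem hasChainFrom_derived {I J : ℕ} (l : List (ℕ × ℕ)) : ∀ i j,
    IsRectChain (IsBwd false false) m I J ((i, j) :: l) →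
    ∃ w, HasChainFrom (derived rulene.out m) I J i j w ∧
      chainValue false false m ((i, j) :: l) + growth rulene.out m (i + 1) j ≤
        w + 1 + growth rulene.out m i j := by
  induction l with
  | nil =>
    rintro i j ⟨-, h2⟩
    obtain ⟨hi, hj, -⟩ := h2 (i, j) (by simp)
    refine ⟨_, (HasChainFrom.zero (i := i) (j := j + 1)).extend le_rfl j.le_succ
      (Or.inr j.lt_succ_self) hi hj, ?_⟩
    have h3 := rulene.derived_add (allowed_rulene m) i j
    have h4 := (rulene.growth_stepBound (allowed_rulene m) i (j + 1)).1.2 rfl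
    simp only [chainValue_cons, chainValue_nil, weight, and_self, if_true]
    omega
  | cons q l ih =>
    rintro i j ⟨h1, h2⟩
    obtain ⟨i', j'⟩ := q
    obtain ⟨hI, hJ, -⟩ := h2 (i, j) (by simp)
    obtain ⟨hI', hJ', hne⟩ := h2 (i', j') (by simp)
    rw [List.pairwise_cons] at h1
    obtain ⟨h3, h4, h5, -⟩ := h1.1 (i', j') (by simp)
    obtain ⟨w, hw, hle⟩ := ih i' j' ⟨h1.2, fun c hc => h2 c (List.mem_cons_of_mem _ hc)⟩
    simp only at hI hJ hI' hJ' hne h4 h5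
    rw [chainValue_cons]
    simp only [weight, and_self, if_true]
    refine ⟨_, (hw.extend_up hI hJ' h4).extend_left hI hJ'.le h5, ?_⟩
    have t1 := rulene.sum_column_derived (allowed_rulene m) (j := j') h4
    have t2 := rulene.sum_row_derived (allowed_rulene m) (i := i) h5
    have d1 := growth_rulene_diag (m := m) (Or.inl hne)
    have d2 := growth_rulene_diag_le (m := m) i j'
    rcases h5.lt_or_eq with hlt | rfl
    · have c1 := le_sum_row m i hlt
      rcases h4.lt_or_eq with hlt' | rfl
      · omega
      · simp only [Finset.Ico_self, Finset.sum_empty] at t1 ⊢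
        omega
    · have hlt' : i' < i := lt_of_le_of_ne h4 fun he => h3 (by rw [he])
      have c1 := le_sum_column m j hlt'
      simp only [Finset.Ico_self, Finset.sum_empty] at t2 ⊢
      omega

/-- Now the paths turn the other way: left along row `i'` to column `j`, then up. The potential is
`g(i + 1, j + 1) - g(i + 1, j)`, and the path continues down to row `0` at the end of the chain. -/
theorem hasChainFrom_of_derived {I J : ℕ} (l : List (ℕ × ℕ)) : ∀ i j,
    IsRectChain (IsBwd false false) (derived rulene.out m) I J ((i, j) :: l) →
    ∃ w, HasChainFrom m I J i j w ∧
      chainValue false false (derived rulene.out m) ((i, j) :: l) +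
        growth rulene.out m (i + 1) (j + 1) ≤ w + growth rulene.out m (i + 1) j := by
  induction l with
  | nil =>
    rintro i j ⟨-, h2⟩
    obtain ⟨hi, hj, -⟩ := h2 (i, j) (by simp)
    simp only at hi hj
    refine ⟨_, ((HasChainFrom.zero (i := 0) (j := j + 1)).extend le_rfl j.le_succ
      (Or.inr j.lt_succ_self) (by omega) hj).extend_up hi hj (Nat.zero_le i), ?_⟩
    have h3 := rulene.derived_add (allowed_rulene m) 0 j
    have t1 := rulene.sum_column_derived (allowed_rulene m) (j := j) (Nat.zero_le i)
    simp only [growth_zero_left, zero_add] at h3 t1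
    simp only [chainValue_cons, chainValue_nil, weight, and_self, if_true, add_zero, zero_add]
    rcases Nat.eq_zero_or_pos i with rfl | hpos
    · simp only [Finset.Ico_self, Finset.sum_empty, zero_add] at t1 ⊢
      omega
    · have c1 := le_sum_column (derived rulene.out m) j hpos
      omega
  | cons q l ih =>
    rintro i j ⟨h1, h2⟩
    obtain ⟨i', j'⟩ := q
    obtain ⟨hI, hJ, -⟩ := h2 (i, j) (by simp)
    obtain ⟨hI', hJ', hne⟩ := h2 (i', j') (by simp)
    rw [List.pairwise_cons] at h1
    obtain ⟨h3, h4, h5, -⟩ := h1.1 (i', j') (by simp)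
    obtain ⟨w, hw, hle⟩ := ih i' j' ⟨h1.2, fun c hc => h2 c (List.mem_cons_of_mem _ hc)⟩
    simp only at hI hJ hI' hJ' hne h4 h5
    rw [chainValue_cons]
    simp only [weight, and_self, if_true]
    refine ⟨_, (hw.extend_left hI' hJ'.le h5).extend_up hI hJ h4, ?_⟩
    have t1 := rulene.sum_column_derived (allowed_rulene m) (j := j) h4
    have t2 := rulene.sum_row_derived (allowed_rulene m) (i := i') h5
    have d1 := growth_rulene_diag (m := m) (Or.inr hne)
    have d2 := growth_rulene_diag_le (m := m) i' j
    rcases h4.lt_or_eq with hlt | rfl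
    · have c1 := le_sum_column (derived rulene.out m) j hlt
      omega
    · have hlt' : j < j' := lt_of_le_of_ne h5 fun he => h3 (by rw [he])
      have c1 := le_sum_row (derived rulene.out m) i' hlt'
      simp only [Finset.Ico_self, Finset.sum_empty] at t1 ⊢
      omega

theorem isGreatest_conj_rulene (m : ℕ → ℕ → ℕ) (I J : ℕ) :
    IsGreatest (chainLengths (IsBwd false false) false false m I J)
      (conj (shape rulene.out m I J) 0) := by
  refine rulene.isGreatest_conj_shape ?_ ?_ (allowed_rulene m) I J
  · rintro m - I J (_ | ⟨⟨i, j⟩, l⟩) hnil hl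
    · exact absurd rfl hnil
    obtain ⟨hI, hJ, hne⟩ := hl.2 (i, j) (by simp)
    simp only at hI hJ hne
    obtain ⟨w, hw, hle⟩ := hasChainFrom_of_derived l i j hl
    -- Continuing to column `0`, where the growth vanishes, turns the potential into the diagonal
    -- step `g(i + 1, j + 1) - g(i, j) = 1`: this is the gain.
    obtain ⟨l', h1, -, h3⟩ := hw.extend_left hI hJ.le (Nat.zero_le j)
    have t1 := rulene.sum_row_derived (allowed_rulene m) (i := i) (Nat.zero_le j)
    have d1 := growth_rulene_diag (m := m) (Or.inr hne)
    simp only [growth_zero_right] at t1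
    refine ⟨l', h1, ?_⟩
    simp only [Bool.not_true]
    omega
  · rintro m - I J (_ | ⟨⟨i, j⟩, l⟩) hnil hl
    · exact absurd rfl hnil
    obtain ⟨w, ⟨l', h1, -, h3⟩, hle⟩ := hasChainFrom_derived l i j hl
    have := (rulene.growth_stepBound (allowed_rulene m) i j).1.1
    refine ⟨l', h1, ?_⟩
    simp only [Bool.not_true]
    omega

end ne

end GrowthRule

/-! ### The sum of the entries -/

namespace GrowthRule

variable {a b : Bool} (R : GrowthRule a b)

theorem sum_rectangle_derived {m : ℕ → ℕ → ℕ} (hm : ∀ i j, Allowed a b (m i j)) (I J : ℕ) :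
    growth R.out m I J + ∑ i ∈ Finset.range I, ∑ j ∈ Finset.range J, derived R.out m i j =
      ∑ i ∈ Finset.range I, ∑ j ∈ Finset.range J, m i j := by
  induction I with
  | zero => simp
  | succ I ih =>
    rw [Finset.sum_range_succ, Finset.sum_range_succ]
    have := R.sum_row_derived hm (i := I) (Nat.zero_le J)
    simp only [← Finset.range_eq_Ico, growth_zero_right] at this
    omega

theorem sum_shape {m : ℕ → ℕ → ℕ} (hm : ∀ i j, Allowed a b (m i j)) {I J N : ℕ}
    (hN : shape R.out m I J N = 0) :
    ∑ k ∈ Finset.range N, shape R.out m I J k =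
      ∑ i ∈ Finset.range I, ∑ j ∈ Finset.range J, m i j := by
  induction N generalizing m with
  | zero =>
    rw [Finset.sum_range_zero]
    symm
    refine Finset.sum_eq_zero fun i hi => Finset.sum_eq_zero fun j hj => ?_
    exact R.eq_zero_of_growth_eq_zero hm hN (Finset.mem_range.mp hi) (Finset.mem_range.mp hj)
  | succ N ih =>
    rw [Finset.sum_range_succ', ← R.sum_rectangle_derived hm]
    simp only [shape_succ]
    rw [ih (R.allowed_derived hm) hN, add_comm]
    rfl

end GrowthRule

open YoungDiagram in
theorem onBoundary_rowLen (F : YoungDiagram) (i : ℕ) : OnBoundary F.cells i (F.rowLen i) ∧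
    OnBoundary F.cells (i + 1) (F.rowLen i) := by
  simp only [OnBoundary, mem_cells, mem_iff_lt_rowLen]
  refine ⟨⟨lt_irrefl _, ?_⟩, not_lt.mpr (F.rowLen_anti _ _ i.le_succ), ?_⟩
  · rintro i' j' hi hj
    have := F.rowLen_anti _ _ (show i' ≤ i by omega)
    omega
  · rintro i' j' hi hj
    obtain rfl : i' = i := by omega
    omega

theorem sum_cells_eq (F : YoungDiagram) {m : ℕ → ℕ → ℕ} (hm : ∀ i j, (i, j) ∉ F.cells → m i j = 0) :
    ∑ c ∈ F.cells, m c.1 c.2 =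
      ∑ i ∈ Finset.range (F.colLen 0), ∑ j ∈ Finset.range (F.rowLen i), m i j := by
  have h1 : ∀ i, ∑ j ∈ Finset.range (F.rowLen i), m i j =
      ∑ j ∈ Finset.range (F.rowLen 0), m i j := fun i =>
    Finset.sum_subset (Finset.range_subset_range.mpr (F.rowLen_anti _ _ (Nat.zero_le i)))
      fun j _ hj => hm i j fun hmem => hj (Finset.mem_range.mpr
        (YoungDiagram.mem_iff_lt_rowLen.mp ((YoungDiagram.mem_cells _).mp hmem)))
  rw [Finset.sum_congr rfl fun i _ => h1 i,
    ← Finset.sum_product' (f := fun i j => m i j)]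
  refine Finset.sum_subset (fun c hc => ?_) fun c _ hc => hm c.1 c.2 hc
  obtain ⟨i, j⟩ := c
  have hc' := (YoungDiagram.mem_cells _).mp hc
  have h2 := YoungDiagram.mem_iff_lt_rowLen.mp hc'
  have h3 := YoungDiagram.mem_iff_lt_colLen.mp hc'
  have h4 := F.rowLen_anti _ _ (Nat.zero_le i)
  have h5 := F.colLen_anti _ _ (Nat.zero_le j)
  simp only [Finset.mem_product, Finset.mem_range]
  omega

/-- The sum of row `i` is the difference of the rectangle sums at two boundary points, the ends of
the vertical boundary step of that row. -/
theorem sum_cells_congr (F : YoungDiagram) {m m' : ℕ → ℕ → ℕ}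
    (hm : ∀ i j, (i, j) ∉ F.cells → m i j = 0) (hm' : ∀ i j, (i, j) ∉ F.cells → m' i j = 0)
    (h : ∀ I J, OnBoundary F.cells I J → ∑ i ∈ Finset.range I, ∑ j ∈ Finset.range J, m i j =
      ∑ i ∈ Finset.range I, ∑ j ∈ Finset.range J, m' i j) :
    ∑ c ∈ F.cells, m c.1 c.2 = ∑ c ∈ F.cells, m' c.1 c.2 := by
  rw [sum_cells_eq F hm, sum_cells_eq F hm']
  refine Finset.sum_congr rfl fun i _ => ?_
  have h1 := h _ _ (onBoundary_rowLen F i).1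
  have h2 := h _ _ (onBoundary_rowLen F i).2
  rw [Finset.sum_range_succ, Finset.sum_range_succ, h1] at h2
  exact Nat.add_left_cancel h2

/-! ### The bijection between fillings with conjugate boundary data -/

/-- `s` is the largest value of `g` on the boundary of `F`. -/
def IsBoundaryMax (F : Finset (ℕ × ℕ)) (g : ℕ → ℕ → ℕ) (s : ℕ) : Prop :=
  (∃ i j, OnBoundary F i j ∧ g i j = s) ∧ ∀ i j, OnBoundary F i j → g i j ≤ s

theorem IsBoundaryMax.congr {F : Finset (ℕ × ℕ)} {g g' : ℕ → ℕ → ℕ} {s : ℕ}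
    (h : ∀ i j, OnBoundary F i j → g i j = g' i j) (hg : IsBoundaryMax F g s) :
    IsBoundaryMax F g' s := by
  obtain ⟨⟨i, j, h1, h2⟩, h3⟩ := hg
  exact ⟨⟨i, j, h1, by rw [← h i j h1, h2]⟩, fun i j hij => by rw [← h i j hij]; exact h3 i j hij⟩

/-- The fillings of `F` with sum `n`, largest first row length `s` and largest number of rows `t`
along the boundary. -/
def boundedFillings {a b : Bool} (R : GrowthRule a b) (F : YoungDiagram) (n s t : ℕ) :
    Set (ℕ → ℕ → ℕ) :=
  {m | IsFillingOf a b F.cells m ∧ ∑ c ∈ F.cells, m c.1 c.2 = n ∧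
    IsBoundaryMax F.cells (fun i j => shape R.out m i j 0) s ∧
    IsBoundaryMax F.cells (fun i j => conj (shape R.out m i j) 0) t}

section dual

variable {a b a' b' : Bool} (R : GrowthRule a b) (R' : GrowthRule a' b') {F : YoungDiagram}
  {n s t : ℕ}

theorem exists_conj_filling (ha : a' = !a) (hb : b' = !b) {m : ℕ → ℕ → ℕ}
    (hm : IsFillingOf a b F.cells m) : ∃ m', IsFillingOf a' b' F.cells m' ∧
      ∀ i j, OnBoundary F.cells i j → shape R'.out m' i j = conj (shape R.out m i j) := by
  subst ha hb
  exact R'.exists_filling F.isLowerSet (hm.isBoundaryData R).conj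

theorem mem_boundedFillings_of_conj {m m' : ℕ → ℕ → ℕ}
    (hm' : IsFillingOf a' b' F.cells m')
    (h : ∀ i j, OnBoundary F.cells i j → shape R'.out m' i j = conj (shape R.out m i j))
    (hm : m ∈ boundedFillings R F n s t) : m' ∈ boundedFillings R' F n t s := by
  obtain ⟨hf, hn, hs, ht⟩ := hm
  have hpart : ∀ i j, IsPartition (shape R.out m i j) := fun i j => (R.shape_valid hf.allowed i j).1
  refine ⟨hm', ?_, ht.congr fun i j hij => by rw [h i j hij],
    hs.congr fun i j hij => by rw [h i j hij, (hpart i j).conj_conj]⟩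
  rw [← hn]
  -- At a boundary point both rectangle sums are the size of the partition, which conjugation
  -- preserves.
  refine sum_cells_congr F hm'.support hf.support fun I J hIJ => ?_
  obtain ⟨N, hN⟩ := (hpart I J).eventually_zero
  obtain ⟨M, hM⟩ := (hpart I J).conj.eventually_zero
  have hM' : shape R.out m I J 0 ≤ M := by
    by_contra hlt
    have := (hpart I J).lt_conj.mpr (not_le.mp hlt)
    omega
  rw [← R.sum_shape hf.allowed hN, ← sum_conj (hpart I J) hM' hN, ← h I J hIJ]
  rw [← h I J hIJ] at hM
  exact (R'.sum_shape hm'.allowed hM).symm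

theorem ncard_boundedFillings (ha : a' = !a) (hb : b' = !b) :
    (boundedFillings R F n s t).ncard = (boundedFillings R' F n t s).ncard := by
  have hex : ∀ m, IsFillingOf a b F.cells m → ∃ m', IsFillingOf a' b' F.cells m' ∧
      ∀ i j, OnBoundary F.cells i j → shape R'.out m' i j = conj (shape R.out m i j) :=
    fun m hm => exists_conj_filling R R' ha hb hm
  choose φ hφ hφc using hex
  refine Set.ncard_congr (fun m hm => φ m hm.1)
    (fun m hm => mem_boundedFillings_of_conj R R' (hφ m hm.1) (hφc m hm.1) hm)
    (fun m₁ m₂ h₁ h₂ he => ?_) fun m' hm' => ?_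
  · refine R.filling_unique F.isLowerSet h₁.1 h₂.1 fun i j hij => ?_
    rw [← (R.shape_valid h₁.1.allowed i j).1.conj_conj,
      ← (R.shape_valid h₂.1.allowed i j).1.conj_conj, ← hφc m₁ h₁.1 i j hij,
      ← hφc m₂ h₂.1 i j hij, he]
  · obtain ⟨m, hm, hmc⟩ := exists_conj_filling R' R (by simp [ha]) (by simp [hb]) hm'.1
    refine ⟨m, mem_boundedFillings_of_conj R' R hm hmc hm', ?_⟩
    refine R'.filling_unique F.isLowerSet (hφ m hm) hm'.1 fun i j hij => ?_
    rw [hφc m hm i j hij, hmc i j hij, (R'.shape_valid hm'.1.allowed i j).1.conj_conj]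

end dual

/-! ### Chains in Ferrers shapes -/

open FerrersFilling

/-- Walk from the cell along the diagonal until `F` is left. -/
theorem exists_onBoundary_gt (F : YoungDiagram) {i j : ℕ} (h : (i, j) ∈ F) :
    ∃ p q, OnBoundary F.cells p q ∧ i < p ∧ j < q := by
  have hex : ∃ k, (i + k, j + k) ∉ F := by
    refine ⟨F.rowLen 0, fun hk => ?_⟩
    have h1 := YoungDiagram.mem_iff_lt_rowLen.mp hk
    have h2 := F.rowLen_anti _ _ (Nat.zero_le (i + F.rowLen 0))
    omega
  classical
  have hpos : 0 < Nat.find hex := by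
    rw [Nat.find_pos]
    simpa using h
  refine ⟨i + Nat.find hex, j + Nat.find hex,
    ⟨fun hm => Nat.find_spec hex ((YoungDiagram.mem_cells _).mp hm), fun i' j' hi hj => ?_⟩,
    by omega, by omega⟩
  have := Nat.find_min hex (show Nat.find hex - 1 < Nat.find hex by omega)
  rw [not_not] at this
  rw [YoungDiagram.mem_cells]
  convert this using 2 <;> omega

/-- The extension of a filling by zero. -/
def extend {F : YoungDiagram} (f : Filling F) (i j : ℕ) : ℕ :=
  if h : (i, j) ∈ F then f ⟨(i, j), h⟩ else 0

theorem extend_apply {F : YoungDiagram} (f : Filling F) (c : Cell F) :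
    extend f c.1.1 c.1.2 = f c := dif_pos c.2

theorem extend_of_notMem {F : YoungDiagram} (f : Filling F) {i j : ℕ} (h : (i, j) ∉ F) :
    extend f i j = 0 := dif_neg h

theorem extend_injective (F : YoungDiagram) :
    Function.Injective (extend : Filling F → ℕ → ℕ → ℕ) := fun f g h =>
  funext fun c => by rw [← extend_apply f, h, extend_apply]

theorem sum_extend {F : YoungDiagram} (f : Filling F) :
    ∑ c ∈ F.cells, extend f c.1 c.2 = ∑ c, f c := by
  rw [← Finset.sum_coe_sort F.cells fun c => extend f c.1 c.2]
  exact Finset.sum_congr rfl fun c _ => extend_apply f c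

section chains

variable {F : YoungDiagram} {f : Filling F} {Dir : Cell F → Cell F → Prop}
  {Rel : ℕ × ℕ → ℕ × ℕ → Prop} (htrans : ∀ x y z, Dir x y → Dir y z → Dir x z)
  (hrel : ∀ x y : Cell F, Rel x.1 y.1 ↔ x ≠ y ∧ Dir x y)

include hrel

theorem exists_isFillingChain {p q : ℕ} (hpq : OnBoundary F.cells p q) {l : List (ℕ × ℕ)}
    (hl : IsRectChain Rel (extend f) p q l) :
    ∃ l' : List (Cell F), IsFillingChain f Dir l' ∧ l'.map Subtype.val = l := by
  have hmem : ∀ c ∈ l, c ∈ F := fun c hc => by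
    by_contra hF
    exact (hl.2 c hc).2.2 (extend_of_notMem f hF)
  lift l to List (Cell F) using hmem
  obtain ⟨h1, h2⟩ := hl
  rw [List.pairwise_map] at h1
  have h1' := h1.imp fun {x y} h => (hrel x y).mp h
  have h3 : ∀ c ∈ l, c.row < p ∧ c.col < q ∧ f c ≠ 0 := fun c hc => by
    have := h2 c.1 (List.mem_map_of_mem hc)
    rw [extend_apply] at this
    exact this
  refine ⟨l, ⟨(h1'.imp fun h => h.2).isChain, h1'.imp fun h => h.1, fun c hc => (h3 c hc).2.2,
    ?_⟩, rfl⟩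
  rintro i j ⟨-, ⟨x, hx, hxi⟩, -, ⟨y, hy, hyj⟩⟩
  have h4 := h3 x hx
  have h5 := h3 y hy
  have h6 := (YoungDiagram.mem_cells _).mp (hpq.2 (p - 1) (q - 1) (by omega) (by omega))
  exact F.up_left_mem (by omega) (by omega) h6

include htrans

theorem exists_isRectChain {l : List (Cell F)} (hl : IsFillingChain f Dir l) :
    ∃ p q, OnBoundary F.cells p q ∧ IsRectChain Rel (extend f) p q (l.map Subtype.val) := by
  have : IsTrans (Cell F) Dir := ⟨htrans⟩
  have hpair : (l.map Subtype.val).Pairwise Rel := by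
    rw [List.pairwise_map]
    refine (hl.nodup.and (List.isChain_iff_pairwise.mp hl.step)).imp fun h => (hrel _ _).mpr h
  obtain ⟨p, q, hpq, hlt⟩ : ∃ p q, OnBoundary F.cells p q ∧ ∀ c ∈ l, c.row < p ∧ c.col < q := by
    by_cases hnil : l = []
    · exact ⟨0, F.rowLen 0, (onBoundary_rowLen F 0).1, by simp [hnil]⟩
    · have hne : l.toFinset.Nonempty := List.toFinset_nonempty_iff l |>.mpr hnil
      obtain ⟨x, hx, hxmax⟩ := l.toFinset.exists_max_image Cell.row hne
      obtain ⟨y, hy, hymax⟩ := l.toFinset.exists_max_image Cell.col hne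
      simp only [List.mem_toFinset] at hx hxmax hy hymax
      -- The top right cell of the bounding rectangle is in `F`; a boundary point beyond it
      -- dominates the whole chain.
      obtain ⟨p, q, hpq, hp, hq⟩ := exists_onBoundary_gt F (hl.rectangle x.row y.col
        ⟨⟨x, hx, le_rfl⟩, ⟨x, hx, le_rfl⟩, ⟨y, hy, le_rfl⟩, ⟨y, hy, le_rfl⟩⟩)
      exact ⟨p, q, hpq, fun c hc => ⟨(hxmax c hc).trans_lt hp, (hymax c hc).trans_lt hq⟩⟩
  refine ⟨p, q, hpq, hpair, fun c hc => ?_⟩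
  obtain ⟨x, hx, rfl⟩ := List.mem_map.mp hc
  refine ⟨(hlt x hx).1, (hlt x hx).2, ?_⟩
  rw [extend_apply]
  exact hl.nonzero x hx

theorem isGreatest_chains_iff {a b : Bool} {val : List (Cell F) → ℕ}
    (hval : ∀ l, (∀ c ∈ l, f c ≠ 0) → chainValue a b (extend f) (l.map Subtype.val) = val l)
    {g : ℕ → ℕ → ℕ} (hg : ∀ i j, IsGreatest (chainLengths Rel a b (extend f) i j) (g i j)) (s : ℕ) :
    IsGreatest {m | ∃ l, IsFillingChain f Dir l ∧ val l = m} s ↔ IsBoundaryMax F.cells g s := by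
  have hle : ∀ i j, OnBoundary F.cells i j →
      ∃ l, IsFillingChain f Dir l ∧ val l = g i j := by
    intro i j hij
    obtain ⟨l, hl, hv⟩ := (hg i j).1
    obtain ⟨l', hl', rfl⟩ := exists_isFillingChain hrel hij hl
    exact ⟨l', hl', by rw [← hv, hval l' hl'.nonzero]⟩
  have hge : ∀ l, IsFillingChain f Dir l → ∃ i j, OnBoundary F.cells i j ∧ val l ≤ g i j := by
    intro l hl
    obtain ⟨p, q, hpq, hr⟩ := exists_isRectChain htrans hrel hl
    exact ⟨p, q, hpq, (hg p q).2 ⟨_, hr, hval l hl.nonzero⟩⟩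
  constructor
  · rintro ⟨⟨l, hl, rfl⟩, hub⟩
    have hbound : ∀ i j, OnBoundary F.cells i j → g i j ≤ val l := fun i j hij => hub (hle i j hij)
    obtain ⟨i, j, hij, hv⟩ := hge l hl
    exact ⟨⟨i, j, hij, le_antisymm (hbound i j hij) hv⟩, hbound⟩
  · rintro ⟨⟨i, j, hij, rfl⟩, hub⟩
    refine ⟨hle i j hij, ?_⟩
    rintro d ⟨l, hl, rfl⟩
    obtain ⟨i', j', hij', hv⟩ := hge l hl
    exact hv.trans (hub i' j' hij')

theorem longestByCard_iff {a b : Bool} (hab : a = true ∨ b = true) {g : ℕ → ℕ → ℕ}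
    (hg : ∀ i j, IsGreatest (chainLengths Rel a b (extend f) i j) (g i j)) (s : ℕ) :
    LongestByCard f Dir s ↔ IsBoundaryMax F.cells g s :=
  isGreatest_chains_iff htrans hrel (fun l hl => by
    rw [chainValue_eq_length hab, List.length_map]
    simp only [List.mem_map, forall_exists_index, and_imp]
    rintro _ x hx rfl
    rw [extend_apply]
    exact hl x hx) hg s

theorem longestBySum_iff {g : ℕ → ℕ → ℕ}
    (hg : ∀ i j, IsGreatest (chainLengths Rel false false (extend f) i j) (g i j)) (s : ℕ) :
    LongestBySum f Dir s ↔ IsBoundaryMax F.cells g s :=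
  isGreatest_chains_iff htrans hrel (fun l _ => by
    rw [chainValue, List.map_map]
    congr 1
    refine List.map_congr_left fun x _ => ?_
    simp only [Function.comp, extend_apply, weight, and_self, if_true]) hg s

end chains

/-! ### The four counting functions in terms of boundary data -/

theorem ncard_fillings {a b : Bool} (R : GrowthRule a b) (F : YoungDiagram) (n s t : ℕ)
    {S : Set (Filling F)} {P : Filling F → Prop}
    (hS : ∀ f, f ∈ S ↔ (∀ c, Allowed a b (f c)) ∧ ∑ c, f c = n)
    (hP : ∀ f, (∀ i j, Allowed a b (extend f i j)) →
      (P f ↔ IsBoundaryMax F.cells (fun i j => shape R.out (extend f) i j 0) s ∧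
        IsBoundaryMax F.cells (fun i j => conj (shape R.out (extend f) i j) 0) t)) :
    {f ∈ S | P f}.ncard = (boundedFillings R F n s t).ncard := by
  have hall : ∀ f : Filling F, (∀ c, Allowed a b (f c)) → ∀ i j, Allowed a b (extend f i j) := by
    intro f hf i j
    unfold extend
    split_ifs
    · exact hf _
    · simp [Allowed]
  rw [← Set.ncard_image_of_injective _ (extend_injective F)]
  congr 1
  ext m
  constructor
  · rintro ⟨f, ⟨hf, hPf⟩, rfl⟩
    obtain ⟨h1, h2⟩ := (hS f).mp hf
    obtain ⟨h3, h4⟩ := (hP f (hall f h1)).mp hPf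
    exact ⟨⟨fun i j hij => extend_of_notMem f fun h => hij ((YoungDiagram.mem_cells _).mpr h),
      hall f h1⟩, by rw [sum_extend, h2], h3, h4⟩
  · rintro ⟨⟨h0, h1⟩, h2, h3, h4⟩
    have hext : extend (fun c : Cell F => m c.1.1 c.1.2) = m := by
      funext i j
      unfold extend
      split_ifs with h
      · rfl
      · exact (h0 i j fun hm => h ((YoungDiagram.mem_cells _).mp hm)).symm
    refine ⟨fun c => m c.1.1 c.1.2, ⟨(hS _).mpr ⟨fun c => h1 _ _, ?_⟩, ?_⟩, hext⟩
    · rw [← sum_extend, hext, h2]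
    · rw [hP _ (by rw [hext]; exact h1), hext]
      exact ⟨h3, h4⟩

theorem mem_fillings_iff {a : Bool} {F : YoungDiagram} {n : ℕ} (f : Filling F) :
    f ∈ fillings F n ↔ (∀ c, Allowed a a (f c)) ∧ ∑ c, f c = n := by
  simp [fillings, Allowed]

theorem mem_fillings01_iff {a b : Bool} (hab : a ≠ b) {F : YoungDiagram} {n : ℕ} (f : Filling F) :
    f ∈ fillings01 F n ↔ (∀ c, Allowed a b (f c)) ∧ ∑ c, f c = n := by
  simp only [fillings01, Set.mem_ofPred_eq, Allowed, hab, ne_eq, not_false_eq_true, forall_const,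
    Nat.le_one_iff_eq_zero_or_eq_one]

theorem isFwd_iff {F : YoungDiagram} {a b : Bool} {Dir : Cell F → Cell F → Prop}
    (h : ∀ x y, Dir x y ↔ (if a then x.row < y.row else x.row ≤ y.row) ∧
      (if b then x.col < y.col else x.col ≤ y.col)) (x y : Cell F) :
    IsFwd a b x.1 y.1 ↔ x ≠ y ∧ Dir x y := by
  rw [h, IsFwd, ne_eq, ← Subtype.ext_iff]
  unfold Cell.row Cell.col
  cases a <;> cases b <;> simp <;> grind

theorem isBwd_iff {F : YoungDiagram} {a b : Bool} {Dir : Cell F → Cell F → Prop}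
    (h : ∀ x y, Dir x y ↔ (if a then y.row < x.row else y.row ≤ x.row) ∧
      (if b then x.col < y.col else x.col ≤ y.col)) (x y : Cell F) :
    IsBwd a b x.1 y.1 ↔ x ≠ y ∧ Dir x y := by
  rw [h, IsBwd, ne_eq, ← Subtype.ext_iff]
  unfold Cell.row Cell.col
  cases a <;> cases b <;> simp <;> grind

theorem countNEse_eq (F : YoungDiagram) (n s t : ℕ) :
    countNEse F n s t = (boundedFillings ruleNE F n s t).ncard := by
  refine ncard_fillings ruleNE F n s t mem_fillings_iff fun f hf => ?_
  rw [longestBySum_iff (by unfold NE; omega) (isFwd_iff (a := false) (b := false) (by simp [NE]))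
      fun i j => ruleNE.isGreatest_growth hf i j,
    longestByCard_iff (by unfold se; omega) (isBwd_iff (a := true) (b := true) (by simp [se]))
      (by simp) fun i j => GrowthRule.isGreatest_conj_ruleNE _ i j]
  rfl

theorem countneSE_eq (F : YoungDiagram) (n s t : ℕ) :
    countneSE F n s t = (boundedFillings rulene F n s t).ncard := by
  refine ncard_fillings rulene F n s t mem_fillings_iff fun f hf => ?_
  rw [longestByCard_iff (by unfold ne; omega) (isFwd_iff (a := true) (b := true) (by simp [ne]))
      (by simp) fun i j => rulene.isGreatest_growth hf i j,
    longestBySum_iff (by unfold SE; omega) (isBwd_iff (a := false) (b := false) (by simp [SE]))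
      fun i j => GrowthRule.isGreatest_conj_rulene _ i j]
  rfl

theorem count01nESe_eq (F : YoungDiagram) (n s t : ℕ) :
    count01nESe F n s t = (boundedFillings rulenE F n s t).ncard := by
  refine ncard_fillings rulenE F n s t (mem_fillings01_iff (by simp)) fun f hf => ?_
  rw [longestByCard_iff (by unfold nE; omega) (isFwd_iff (a := true) (b := false) (by simp [nE]))
      (by simp) fun i j => rulenE.isGreatest_growth hf i j,
    longestByCard_iff (by unfold Se; omega) (isBwd_iff (a := false) (b := true) (by simp [Se]))
      (by simp) fun i j => GrowthRule.isGreatest_conj_rulenE hf i j]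
  rfl

theorem count01NesE_eq (F : YoungDiagram) (n s t : ℕ) :
    count01NesE F n s t = (boundedFillings ruleNe F n s t).ncard := by
  refine ncard_fillings ruleNe F n s t (mem_fillings01_iff (by simp)) fun f hf => ?_
  rw [longestByCard_iff (by unfold FerrersFilling.Ne; omega) (isFwd_iff (a := false) (b := true) (by simp [FerrersFilling.Ne]))
      (by simp) fun i j => ruleNe.isGreatest_growth hf i j,
    longestByCard_iff (by unfold sE; omega) (isBwd_iff (a := true) (b := false) (by simp [sE]))
      (by simp) fun i j => GrowthRule.isGreatest_conj_ruleNe hf i j]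
  rfl

end FerrersGrowth

theorem theorem13 (F : YoungDiagram) (n s t : ℕ) (hs : 0 < s) (ht : 0 < t) :
    FerrersFilling.countNEse F n s t = FerrersFilling.countneSE F n t s ∧
    FerrersFilling.count01nESe F n s t = FerrersFilling.count01NesE F n t s := by
  rw [FerrersGrowth.countNEse_eq, FerrersGrowth.countneSE_eq, FerrersGrowth.count01nESe_eq,
    FerrersGrowth.count01NesE_eq]
  exact ⟨FerrersGrowth.ncard_boundedFillings _ _ rfl rfl,
    FerrersGrowth.ncard_boundedFillings _ _ rfl rfl⟩
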